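/- A \emph{PF field} $(K,C)$ is either a number field $K$ (with $C=\operatorname{Spec}\mathcal O_K$), or the function field $K=k(C)$ of a regular projective curve $C$ over a field $k$ (a curve is an integral separated scheme of finite type over $k$ of dimension $1$, not necessarily geometrically integral). Its finite places are the normalized discrete valuations of $K$, required to be trivial on $k$ in the function field case. Its infinite places are the embeddings $K\to\mathbb C$ up to complex conjugation if $K$ is a number field, and there are none if $K$ is a function field. Let $\Omega_K$ be the set of all places. For $v\in\Omega_K$ let $K_v$ be the completion, let $\mathcal O_v=\{x\in K_v: |x|_v\le 1\}$ if $v$ is finite, and let $\mathcal O_v=K_v$ if $v$ is infinite. Let $$\rho(K,C)=\{n\in\mathbb Z_{>0} : \mathcal O_v^\times \text{ is } n\text{-divisible for all } v\in\Omega_K\}.$$ For a prime $p\neq\operatorname{char}(k)$, the field $k$ is \emph{$p$-closed} if every finite extension of $k$ has degree coprime to $p$. A field is \emph{formally real} if it admits an ordering, and \emph{Euclidean} if it admits an ordering for which every nonnegative element is a square. The field $k$ is \emph{hereditarily Euclidean} if it is formally real and every formally real algebraic extension of $k$ is Euclidean. \begin{enumerate} \item If $K$ is a number field, then $\rho(K,C)=\{1\}$.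 \item If $K=k(C)$ for a regular projective curve $C$ over a field $k$, then a prime number $p$ belongs to $\rho(K,C)$ if and only if either \begin{enumerate} \item $p\neq\operatorname{char}(k)$ and $k$ is $p$-closed, or \item $p=2$, $k$ is hereditarily Euclidean, and $C(k')=\emptyset$ for every real closure $k'$ of $k$ (where $C(k')$ is the set of $k'$-points of the $k$-scheme $C$). \end{enumerate} \item For any PF field $(K,C)$ and any positive integer $n\notin\rho(K,C)$, there are infinitely many places $v\in\Omega_K$ such that $\mathcal O_v^\times$ is not $n$-divisible. \end{enumerate} -/

import Mathlib

open CategoryTheory AlgebraicGeometry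
open scoped WithZero

universe u

noncomputable section

/-! ### Fields: orderings, Euclidean fields, real closures, `n`-closed fields -/

/-- A field is formally real if it admits an ordering. -/
def FormallyReal (k : Type u) [Field k] : Prop :=
  ∃ _ : LinearOrder k, IsStrictOrderedRing k

/-- A field is (formally) Euclidean if it admits an ordering for which every nonnegative element
is a square. -/
def FormallyEuclidean (k : Type u) [Field k] : Prop :=
  ∃ _ : LinearOrder k, IsStrictOrderedRing k ∧ ∀ x : k, 0 ≤ x → IsSquare x

/-- A field is hereditarily Euclidean if it is formally real and every formally real algebraic
extension of it is Euclidean. -/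
def HereditarilyEuclidean (k : Type u) [Field k] : Prop :=
  FormallyReal k ∧
    ∀ (l : Type u) [Field l] [Algebra k l] [Algebra.IsAlgebraic k l],
      FormallyReal l → FormallyEuclidean l

/-- `R` is a real closure of `k`: a real closed field that is algebraic over `k`. -/
structure IsRealClosureOf (k R : Type u) [Field k] [Field R] [Algebra k R] : Prop where
  isRealClosed : IsRealClosed R
  isAlgebraic : Algebra.IsAlgebraic k R

/-- A field is `n`-closed if the degree of each of its finite extensions is coprime to `n`. The
notion is used for `n > 1` not divisible by the characteristic. -/
def IsNClosed (n : ℕ) (k : Type u) [Field k] : Prop :=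
  ∀ (l : Type u) [Field l] [Algebra k l] [FiniteDimensional k l],
    Nat.Coprime (Module.finrank k l) n

/-- A commutative (multiplicatively written) group is `n`-divisible if every element is an `n`-th
power. -/
def IsNDivisible (n : ℕ) (G : Type u) [CommGroup G] : Prop :=
  Function.Surjective fun g : G => g ^ n

/-! ### Regular projective curves -/

attribute [local instance] MvPolynomial.gradedAlgebra

/-- The structure morphism `ℙⁿ_k ⟶ Spec k`, where `ℙⁿ_k = Proj k[x₀, …, xₙ]`. -/
def projectiveSpaceStructure (k : Type u) [Field k] (n : ℕ) :
    Proj (MvPolynomial.homogeneousSubmodule (Fin (n + 1)) k) ⟶ Spec (.of k) :=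
  Proj.toSpecZero (MvPolynomial.homogeneousSubmodule (Fin (n + 1)) k) ≫
    Spec.map (CommRingCat.ofHom
      (algebraMap k (MvPolynomial.homogeneousSubmodule (Fin (n + 1)) k 0)))

/-- A curve over a field `k`: an integral separated `k`-scheme of finite type, of dimension `1`. -/
structure IsCurve {k : Type u} [Field k] {C : Scheme.{u}} (f : C ⟶ Spec (.of k)) : Prop where
  isIntegral : IsIntegral C
  isSeparated : IsSeparated f
  locallyOfFiniteType : LocallyOfFiniteType f
  quasiCompact : QuasiCompact f
  dim_eq_one : topologicalKrullDim C = 1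

/-- A regular projective curve over a field `k`. -/
structure IsRegularProjectiveCurve {k : Type u} [Field k] {C : Scheme.{u}}
    (f : C ⟶ Spec (.of k)) : Prop extends IsCurve f where
  isRegular : ∀ x : C, IsRegularLocalRing (C.presheaf.stalk x)
  isProjective : ∃ (n : ℕ) (i : C ⟶ Proj (MvPolynomial.homogeneousSubmodule (Fin (n + 1)) k)),
    IsClosedImmersion i ∧ i ≫ projectiveSpaceStructure k n = f

/-- The set `C(R)` of `R`-points of a `k`-scheme `f : C ⟶ Spec k`, for a `k`-algebra `R`. -/
def PointsOver {k : Type u} [Field k] {C : Scheme.{u}} (f : C ⟶ Spec (.of k))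
    (R : Type u) [Field R] [Algebra k R] : Type u :=
  {g : Spec (.of R) ⟶ C // g ≫ f = Spec.map (CommRingCat.ofHom (algebraMap k R))}

/-- The inclusion of the ground field `k` into the function field of an integral `k`-scheme. -/
def constantsHom {k : Type u} [Field k] {C : Scheme.{u}} [IsIntegral C] (f : C ⟶ Spec (.of k)) :
    k →+* C.functionField :=
  haveI : Nonempty (⊤ : C.Opens) := ⟨⟨genericPoint C, trivial⟩⟩
  ((Scheme.ΓSpecIso (.of k)).inv ≫ f.appTop ≫ C.germToFunctionField ⊤).hom

/-! ### PF fields and their places -/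

/-- A PF field `(K, C)`: either a number field `K` (with `C = Spec 𝓞 K`), or the function field of
a regular projective curve `C` over a field `k`. -/
inductive PFField : Type (u + 1)
  | numberField (K : Type u) [Field K] [NumberField K] : PFField
  | functionField (k : Type u) [Field k] (C : Scheme.{u}) (f : C ⟶ Spec (.of k))
      (hC : IsRegularProjectiveCurve f) : PFField

namespace PFField

/-- The underlying field `K` of a PF field `(K, C)`. -/
def carrier : PFField.{u} → Type u
  | numberField K => K
  | functionField _ C _ hC =>
      haveI := hC.isIntegral
      C.functionField

instance instFieldCarrier : (F : PFField.{u}) → Field F.carrier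
  | numberField K => inferInstanceAs (Field K)
  | functionField _ C _ hC =>
      haveI := hC.isIntegral
      inferInstanceAs (Field C.functionField)

/-- In the function field case: the valuation is trivial on the ground field `k`. There is no
condition for number fields. -/
def TrivialOnConstants : (F : PFField.{u}) → Valuation F.carrier ℤᵐ⁰ → Prop
  | numberField _, _ => True
  | functionField k _ f hC, v =>
      haveI := hC.isIntegral
      ∀ c : k, c ≠ 0 → v (constantsHom f c) = 1

/-- The finite places: normalized (that is, surjective) discrete valuations on `K`, trivial on `k`
in the function field case. -/
def FinitePlace (F : PFField.{u}) : Type u :=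
  {v : Valuation F.carrier ℤᵐ⁰ // Function.Surjective v ∧ F.TrivialOnConstants v}

/-- The infinite places: embeddings into `ℂ` up to conjugation for number fields, none for function
fields. -/
def InfinitePlace : PFField.{u} → Type u
  | numberField K => NumberField.InfinitePlace K
  | functionField _ _ _ _ => PEmpty

/-- The set of places `Ω_K`. -/
abbrev Place (F : PFField.{u}) : Type u := F.FinitePlace ⊕ F.InfinitePlace

/-- `𝒪_v` for a finite place `v`: the elements of valuation `≤ 1` in the completion `K_v`. -/
abbrev finiteLocalRing (F : PFField.{u}) (v : F.FinitePlace) : ValuationSubring v.1.Completion :=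
  (Valued.v : Valuation v.1.Completion ℤᵐ⁰).valuationSubring

/-- The completion `K_v` at an infinite place `v`. -/
def InfiniteCompletion : (F : PFField.{u}) → F.InfinitePlace → Type u
  | numberField K, v => NumberField.InfinitePlace.Completion (K := K) v
  | functionField _ _ _ _, v => PEmpty.elim v

instance instFieldInfiniteCompletion :
    (F : PFField.{u}) → (v : F.InfinitePlace) → Field (F.InfiniteCompletion v)
  | numberField K, v =>
      (fun w : NumberField.InfinitePlace K => (inferInstance : Field w.Completion)) v
  | functionField _ _ _ _, v => PEmpty.elim v

/-- The ring `𝒪_v`, which by convention is all of `K_v` when `v` is an infinite place. -/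
def LocalRing (F : PFField.{u}) : F.Place → Type u
  | .inl v => F.finiteLocalRing v
  | .inr v => F.InfiniteCompletion v

instance instCommRingLocalRing (F : PFField.{u}) : (v : F.Place) → CommRing (F.LocalRing v)
  | .inl v => inferInstanceAs (CommRing (F.finiteLocalRing v))
  | .inr v => inferInstanceAs (CommRing (F.InfiniteCompletion v))

/-- `ρ(K, C)`: the set of positive integers `n` such that `𝒪_v^×` is `n`-divisible for every place
`v`. -/
def rho (F : PFField.{u}) : Set ℕ :=
  {n | 0 < n ∧ ∀ v : F.Place, IsNDivisible n (F.LocalRing v)ˣ}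

end PFField

end

/-! Everything is read off from residue fields. If `𝒪_v^×` is `n`-divisible, every element of the
residue field is an `n`-th power; Hensel's lemma gives the converse when `n` is a unit in the
residue field (`Valuation.residueDivisible_of_isNDivisible`,
`Valuation.isNDivisible_of_residueDivisible`). When `p` is the characteristic of `K`, `1 + t` with
`t` a uniformizer is never a `p`-th power, so every finite place fails. General `n` reduces to its
prime factors.

For a number field, take the infinitely many primes `ℓ ≡ 1` modulo `p`: a residue field of
characteristic `ℓ` contains an element of order `p`, so its `p`-th power map is not injective and,
the field being finite, not surjective.

For a function field with `p ≠ char k`, the residue fields are the quotients `A ⧸ P` of affine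
charts, finite over `k`. Noether normalization embeds every finite separable extension `l` of `k` in
infinitely many of them (`infinite_setOf_nonempty_algHom`). So if almost all residue fields are
closed under `p`-th roots, norms carry this down to `l`, provided `p` is odd or `√-1 ∈ l`. Kummer
theory turns this into `p`-closedness of `k` when `p` is odd or `√-1 ∈ k`; in the remaining case,
computing with `l(√-1)` shows that `k` is hereditarily Euclidean. Conversely, finite extensions of a
`p`-closed field are closed under `p`-th roots. Those of a hereditarily Euclidean field that are not
formally real are closed under square roots, and a formally real residue field would give a point of
`C` over a real closure.

Since only almost all places were used, infinitude of the bad places comes for free except when `p =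
2`, `k` is hereditarily Euclidean and some closed point `P` is bad. Then `P` has odd degree. A
finite map from a chart to the line with a simple zero at `P`, all of whose other zeros have even
degree, has odd degree itself; hence each of the infinitely many rational fibres contains a point of
odd degree, which is again bad (`QuadraticallyClosedOverI.infinite_setOf_not_isSquare_neg_one`). -/

noncomputable section

/-! ### Adic completeness of complete discretely valued rings. -/

namespace Valued

open WithZero Filter Topology

variable {L : Type*} [Field L] [Valued L ℤᵐ⁰]

/-- Completeness supplies a limit for the uniformity; the `t`-adic rate is kept by comparing the
limit with a late enough term of the sequence. -/
theorem exists_cauchy_limit [CompleteSpace L] {t : L} (ht : v t = exp (-1 : ℤ)) (f : ℕ → L)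
    (hf : ∀ {m n}, m ≤ n → v (f n - f m) ≤ v (t ^ m)) :
    ∃ l : L, ∀ n, v (l - f n) ≤ v (t ^ n) := by
  have ht0 : t ≠ 0 := by
    rintro rfl
    exact exp_ne_zero ((map_zero v).symm.trans ht).symm
  have hc : CauchySeq f := by
    rw [(Valued.hasBasis_uniformity L ℤᵐ⁰).cauchySeq_iff']
    intro γ _
    obtain ⟨n, hn⟩ : ∃ n : ℕ, v (t ^ n) < MonoidWithZeroHom.ValueGroup₀.embedding γ.1 := by
      have h0 : MonoidWithZeroHom.ValueGroup₀.embedding γ.1 ≠ 0 := by simp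
      refine ⟨(-log (MonoidWithZeroHom.ValueGroup₀.embedding γ.1) + 1).toNat, ?_⟩
      rw [map_pow, ht, ← exp_nsmul, ← exp_log h0, exp_lt_exp]
      have := Int.self_le_toNat (-log (MonoidWithZeroHom.ValueGroup₀.embedding γ.1) + 1)
      simp only [nsmul_eq_mul, exp_log h0] at *
      linarith
    refine ⟨n, fun m hm => ?_⟩
    change v.restrict (f n - f m) < γ.1
    rw [Valuation.restrict_lt_iff_lt_embedding, Valuation.map_sub_swap]
    exact (hf hm).trans_lt hn
  obtain ⟨l, hl⟩ := cauchySeq_tendsto_of_complete hc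
  refine ⟨l, fun n => ?_⟩
  have hne : v.restrict (t ^ n) ≠ 0 := by simp [ht0]
  have hU : {y : L | v.restrict (y - l) < v.restrict (t ^ n)} ∈ 𝓝 l :=
    Valued.mem_nhds.2 ⟨Units.mk0 _ hne, le_rfl⟩
  obtain ⟨m, hm, hnm⟩ := ((hl.eventually hU).and (eventually_ge_atTop n)).exists
  have h1 : v (f m - l) < v (t ^ n) := (Valuation.restrict_lt_iff _).1 hm
  have : l - f n = (f m - f n) - (f m - l) := by ring
  rw [this]
  exact (Valuation.map_sub _ _ _).trans (max_le (hf hnm) h1.le)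

/-- Powers of the ideal `(t)` are cut out by the inequalities `v x ≤ v (t ^ n)`, so both adic axioms
become statements about the valuation. This makes Hensel's lemma available. -/
theorem isAdicComplete_integers [CompleteSpace L] {t : L} (ht : v t = exp (-1 : ℤ))
    {t' : (v : Valuation L ℤᵐ⁰).valuationSubring} (ht' : (t' : L) = t) :
    IsAdicComplete (Ideal.span {t'}) (v : Valuation L ℤᵐ⁰).valuationSubring := by
  have ht0 : t ≠ 0 := by
    rintro rfl
    exact exp_ne_zero ((map_zero v).symm.trans ht).symm
  have key (x : (v : Valuation L ℤᵐ⁰).valuationSubring) (n : ℕ) :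
      x ∈ Ideal.span {t'} ^ n ↔ v (x : L) ≤ v (t ^ n) := by
    rw [Ideal.span_singleton_pow, Ideal.mem_span_singleton]
    constructor
    · rintro ⟨c, rfl⟩
      have : v (c : L) ≤ 1 := c.2
      push_cast
      rw [ht', map_mul]
      exact mul_le_of_le_one_right' this
    · intro h
      refine ⟨⟨x / t ^ n, ?_⟩, ?_⟩
      · change v ((x : L) / t ^ n) ≤ 1
        rw [map_div₀]
        exact div_le_one_of_le₀ h zero_le
      · apply Subtype.ext
        push_cast
        rw [ht', mul_div_cancel₀]
        exact pow_ne_zero _ ht0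
  refine { haus' := ?_, prec' := ?_ }
  · intro x hx
    by_contra h0
    have h0' : v (x : L) ≠ 0 := by simpa using h0
    have h := hx ((-log (v (x : L))).toNat + 1)
    rw [SModEq.zero, smul_eq_mul, Ideal.mul_top, key, map_pow, ht, ← exp_nsmul, ← exp_log h0',
      exp_le_exp] at h
    have := Int.self_le_toNat (-log (v (x : L)))
    simp only [smul_eq_mul, nsmul_eq_mul, exp_log h0'] at *
    push_cast at h
    linarith
  · intro f hf
    obtain ⟨l, hl⟩ := exists_cauchy_limit ht (fun n => (f n : L)) (by
      intro m n hmn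
      have := hf hmn
      rw [smul_eq_mul, Ideal.mul_top, SModEq.sub_mem, key] at this
      rw [Valuation.map_sub_swap]
      exact this)
    have hl1 : v l ≤ 1 := by
      have h1 : v (f 0 : L) ≤ 1 := (f 0).2
      have h2 := hl 0
      rw [pow_zero, map_one] at h2
      have := Valuation.map_add_le _ h2 h1
      simpa using this
    refine ⟨⟨l, hl1⟩, fun n => ?_⟩
    rw [smul_eq_mul, Ideal.mul_top, SModEq.sub_mem, key, AddSubgroupClass.coe_sub,
      Valuation.map_sub_swap]
    exact hl n

end Valued

/-! ### Divisibility of local units versus the residue field. -/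

namespace Valuation

open WithZero

variable {K : Type u} [Field K] (v : Valuation K ℤᵐ⁰)

/-- The inclusion of a valued field into its completion, as a ring homomorphism. -/
def toCompletionHom : K →+* v.Completion :=
  UniformSpace.Completion.coeRingHom.comp (WithVal.equiv v).symm.toRingHom

theorem valued_toCompletionHom (a : K) : Valued.v (v.toCompletionHom a) = v a :=
  Valued.valuedCompletion_apply (K := WithVal v) ((WithVal.equiv v).symm a)

theorem exists_toCompletionHom_sub_lt_one (x : v.Completion) :
    ∃ a : K, Valued.v (x - v.toCompletionHom a) < 1 := by
  have hU : {y : v.Completion | Valued.v.restrict (y - x) < 1} ∈ nhds x :=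
    Valued.mem_nhds.2 ⟨1, le_rfl⟩
  obtain ⟨y, ⟨a, ha⟩, hy⟩ := UniformSpace.Completion.denseRange_coe.inter_nhds_nonempty hU
  refine ⟨WithVal.equiv v a, ?_⟩
  have : v.toCompletionHom (WithVal.equiv v a) = y := ha
  rw [this, Valuation.map_sub_swap]
  exact Valuation.restrict_lt_one_iff _ |>.1 hy

/-- Every unit of the valuation ring is congruent to an `n`-th power modulo the maximal ideal. -/
def ResidueDivisible (n : ℕ) : Prop :=
  ∀ a : K, v a = 1 → ∃ b : K, v (a - b ^ n) < 1

variable {v}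

theorem isUnit_valuationSubring_iff {L : Type*} [Field L] {w : Valuation L ℤᵐ⁰}
    {x : w.valuationSubring} : IsUnit x ↔ w (x : L) = 1 :=
  (valuationSubring.integers w).isUnit_iff_valuation_eq_one

theorem exists_integer_approx (y : (Valued.v : Valuation v.Completion ℤᵐ⁰).valuationSubring) :
    ∃ (b : K) (b' : (Valued.v : Valuation v.Completion ℤᵐ⁰).valuationSubring),
      (b' : v.Completion) = v.toCompletionHom b ∧
      y - b' ∈ IsLocalRing.maximalIdeal (Valued.v : Valuation v.Completion ℤᵐ⁰).valuationSubring := by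
  obtain ⟨b, hb⟩ := v.exists_toCompletionHom_sub_lt_one (y : v.Completion)
  have hb1 : Valued.v (v.toCompletionHom b) ≤ 1 := by
    have := Valuation.map_sub_le _ (show Valued.v (y : v.Completion) ≤ 1 from y.2) hb.le
    rwa [sub_sub_cancel] at this
  exact ⟨b, ⟨_, hb1⟩, rfl, (mem_maximalIdeal_iff _ _).2 hb⟩

/-- By density, a root in the completed ring is congruent to an element of `K`, and congruent
integers have congruent `n`-th powers. -/
theorem residueDivisible_of_isNDivisible {n : ℕ}
    (h : IsNDivisible n (Valued.v : Valuation v.Completion ℤᵐ⁰).valuationSubringˣ) :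
    v.ResidueDivisible n := by
  intro a ha
  let a' : (Valued.v : Valuation v.Completion ℤᵐ⁰).valuationSubring :=
    ⟨v.toCompletionHom a, (v.valued_toCompletionHom a).trans_le ha.le⟩
  have hu : IsUnit a' := isUnit_valuationSubring_iff.2 ((v.valued_toCompletionHom a).trans ha)
  obtain ⟨y, hy⟩ := h hu.unit
  have hy' : (y : (Valued.v : Valuation v.Completion ℤᵐ⁰).valuationSubring) ^ n = a' :=
    congrArg Units.val hy
  obtain ⟨b, b', hb, hyb⟩ := exists_integer_approx
    (y : (Valued.v : Valuation v.Completion ℤᵐ⁰).valuationSubring)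
  refine ⟨b, ?_⟩
  have h1 := Ideal.mem_of_dvd _ (sub_dvd_pow_sub_pow _ _ n) hyb
  rw [hy', mem_maximalIdeal_iff] at h1
  rw [← valued_toCompletionHom, _root_.map_sub, map_pow, ← hb]
  exact h1

/-- Hensel's lemma: a residual root `b` is a simple root of `X ^ n - u` because the derivative `n *
b ^ (n - 1)` is a unit. -/
theorem isNDivisible_of_residueDivisible (hv : Function.Surjective v) {n : ℕ} (hn : v n = 1)
    (h : v.ResidueDivisible n) :
    IsNDivisible n (Valued.v : Valuation v.Completion ℤᵐ⁰).valuationSubringˣ := by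
  have hn0 : n ≠ 0 := by
    rintro rfl
    simp at hn
  intro u
  obtain ⟨a, a', ha, hua⟩ := exists_integer_approx
    (u : (Valued.v : Valuation v.Completion ℤᵐ⁰).valuationSubring)
  have ha' : IsUnit a' := by
    by_contra h0
    have := Ideal.add_mem _ hua ((IsLocalRing.mem_maximalIdeal _).2 h0)
    rw [sub_add_cancel] at this
    exact (IsLocalRing.mem_maximalIdeal _).1 this u.isUnit
  rw [isUnit_valuationSubring_iff, ha, valued_toCompletionHom] at ha'
  obtain ⟨b, hb⟩ := h a ha'
  have hbn : v (b ^ n) = 1 := by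
    rw [← ha']
    exact v.map_eq_of_sub_lt (by rwa [Valuation.map_sub_swap, ha'])
  have hb1 : v b = 1 := by
    rwa [map_pow, pow_eq_one_iff_of_nonneg zero_le hn0] at hbn
  obtain ⟨t, ht⟩ := hv (exp (-1 : ℤ))
  have ht' : Valued.v (v.toCompletionHom t) = exp (-1 : ℤ) := (v.valued_toCompletionHom t).trans ht
  let t' : (Valued.v : Valuation v.Completion ℤᵐ⁰).valuationSubring :=
    ⟨v.toCompletionHom t, ht'.trans_le (by rw [← exp_zero, exp_le_exp]; norm_num)⟩
  let b' : (Valued.v : Valuation v.Completion ℤᵐ⁰).valuationSubring :=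
    ⟨v.toCompletionHom b, (v.valued_toCompletionHom b).trans_le hb1.le⟩
  have hb' : IsUnit b' := isUnit_valuationSubring_iff.2 ((v.valued_toCompletionHom b).trans hb1)
  have hnu : IsUnit (n : (Valued.v : Valuation v.Completion ℤᵐ⁰).valuationSubring) := by
    rw [isUnit_valuationSubring_iff]
    have := v.valued_toCompletionHom n
    rw [map_natCast] at this
    exact this.trans hn
  have : IsAdicComplete (Ideal.span {t'}) _ := Valued.isAdicComplete_integers ht' (t' := t') rfl
  -- The uniformizer generates the maximal ideal because a value below `1` in `ℤᵐ⁰` is at most `exp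
  -- (-1)`.
  have hspan : Ideal.span {t'} =
      IsLocalRing.maximalIdeal (Valued.v : Valuation v.Completion ℤᵐ⁰).valuationSubring := by
    ext x
    rw [mem_maximalIdeal_iff, Ideal.mem_span_singleton]
    constructor
    · rintro ⟨c, rfl⟩
      have h1 : Valued.v (c : v.Completion) ≤ 1 := c.2
      have h2 : Valued.v (t' : v.Completion) < 1 := by
        rw [show Valued.v (t' : v.Completion) = exp (-1 : ℤ) from ht', ← exp_zero, exp_lt_exp]
        norm_num
      rw [MulMemClass.coe_mul, map_mul]
      exact mul_lt_one_of_lt_of_le h2 h1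
    · intro hx
      have ht0 : v.toCompletionHom t ≠ 0 := by
        intro h0
        rw [h0, map_zero] at ht'
        exact exp_ne_zero ht'.symm
      refine ⟨⟨x / v.toCompletionHom t, ?_⟩, Subtype.ext (mul_div_cancel₀ _ ht0).symm⟩
      rw [mem_valuationSubring_iff, map_div₀, ht']
      rcases eq_or_ne (Valued.v (x : v.Completion)) 0 with h0 | h0
      · simp [h0]
      · refine div_le_one_of_le₀ ?_ zero_le
        rw [← exp_log h0, ← exp_zero, exp_lt_exp] at hx
        rw [← exp_log h0, exp_le_exp]
        omega
  have hmem : b' ^ n - u ∈ Ideal.span {t'} := by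
    rw [hspan]
    have : b' ^ n - u = -((u - a') + (a' - b' ^ n)) := by ring
    rw [this]
    refine neg_mem (add_mem hua ?_)
    rw [mem_maximalIdeal_iff]
    change Valued.v ((a' : v.Completion) - (v.toCompletionHom b) ^ n) < 1
    rwa [ha, ← map_pow, ← _root_.map_sub, valued_toCompletionHom]
  obtain ⟨y, hy, -⟩ := HenselianRing.is_henselian (I := Ideal.span {t'})
    (Polynomial.X ^ n - Polynomial.C
      (u : (Valued.v : Valuation v.Completion ℤᵐ⁰).valuationSubring))
    (Polynomial.monic_X_pow_sub_C _ hn0) b' (by simpa using hmem) (by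
      simpa [Polynomial.derivative_X_pow] using
        (hnu.mul (hb'.pow (n - 1))).map (Ideal.Quotient.mk (Ideal.span {t'})))
  have hy' : y ^ n = u := by simpa [sub_eq_zero] using hy
  have hyu : IsUnit y := by
    rw [← isUnit_pow_iff hn0, hy']
    exact u.isUnit
  exact ⟨hyu.unit, Units.ext hy'⟩

/-- If `1 + t = y ^ p` with `t` of value `exp (-1)`, then Frobenius gives `(y - 1) ^ p = t`,
although `-1` is not a multiple of `p`. -/
theorem not_isNDivisible_of_charP (hv : Function.Surjective v) {p : ℕ} (hp : p.Prime) [CharP K p] :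
    ¬ IsNDivisible p (Valued.v : Valuation v.Completion ℤᵐ⁰).valuationSubringˣ := by
  intro h
  obtain ⟨t, ht⟩ := hv (exp (-1 : ℤ))
  have hlt : v t < 1 := by rw [ht, ← exp_zero, exp_lt_exp]; norm_num
  have h1 : Valued.v (v.toCompletionHom (1 + t)) = 1 := by
    rw [valued_toCompletionHom]
    exact v.map_one_add_of_lt hlt
  obtain ⟨y, hy⟩ := h (isUnit_valuationSubring_iff (x := ⟨_, h1.le⟩).2 h1).unit
  have hy' : ((y : (Valued.v : Valuation v.Completion ℤᵐ⁰).valuationSubring) : v.Completion) ^ p =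
      v.toCompletionHom (1 + t) := congrArg (fun z : (Valued.v : Valuation v.Completion ℤᵐ⁰).valuationSubringˣ =>
      ((z : (Valued.v : Valuation v.Completion ℤᵐ⁰).valuationSubring) : v.Completion)) hy
  have : Fact p.Prime := ⟨hp⟩
  have : CharP v.Completion p := charP_of_injective_ringHom v.toCompletionHom.injective p
  have h2 : (((y : (Valued.v : Valuation v.Completion ℤᵐ⁰).valuationSubring) : v.Completion) - 1) ^ p
      = v.toCompletionHom t := by
    rw [sub_pow_char, hy', map_add, map_one, one_pow, add_sub_cancel_left]
  have h3 := congrArg Valued.v h2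
  rw [map_pow, valued_toCompletionHom, ht] at h3
  set z := Valued.v
    (((y : (Valued.v : Valuation v.Completion ℤᵐ⁰).valuationSubring) : v.Completion) - 1) with hz
  have hz0 : z ≠ 0 := by
    intro h0
    rw [h0, zero_pow hp.ne_zero] at h3
    exact exp_ne_zero h3.symm
  rw [← exp_log hz0, ← exp_nsmul, exp_inj] at h3
  rw [nsmul_eq_mul] at h3
  have h4 : (p : ℤ) ∣ 1 := ⟨-log z, by linarith⟩
  exact hp.one_lt.ne' (by exact_mod_cast Int.eq_one_of_dvd_one (by positivity) h4)

end Valuation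

/-! ### Reduction of divisibility to prime exponents. -/

theorem IsNDivisible.of_mul_left {G : Type u} [CommGroup G] {m n : ℕ} (h : IsNDivisible (m * n) G) :
    IsNDivisible n G := fun g => by
  obtain ⟨x, hx⟩ := h g
  exact ⟨x ^ m, by simpa [pow_mul] using hx⟩

theorem IsNDivisible.mul {G : Type u} [CommGroup G] {m n : ℕ} (hm : IsNDivisible m G)
    (hn : IsNDivisible n G) : IsNDivisible (m * n) G := fun g => by
  obtain ⟨x, rfl⟩ := hn g
  obtain ⟨y, rfl⟩ := hm x
  exact ⟨y, by simp [pow_mul]⟩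

theorem isNDivisible_one {G : Type u} [CommGroup G] : IsNDivisible 1 G := fun g => ⟨g, by simp⟩

theorem isNDivisible_of_forall_prime_dvd {G : Type u} [CommGroup G] {n : ℕ} (hn : n ≠ 0)
    (h : ∀ p : ℕ, p.Prime → p ∣ n → IsNDivisible p G) : IsNDivisible n G := by
  induction n using induction_on_primes with
  | zero => exact absurd rfl hn
  | one => exact isNDivisible_one
  | prime_mul p a hp ih =>
    exact (h p hp (dvd_mul_right _ _)).mul
      (ih (right_ne_zero_of_mul hn) fun q hq hqa => h q hq (hqa.mul_left p))

/-! ### Closure under `p`-th roots, Kummer theory and `p`-closed fields. -/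

open Polynomial IntermediateField Module

/-- Every element of the ring is an `n`-th power. -/
def RootClosed (n : ℕ) (R : Type*) [Monoid R] : Prop :=
  ∀ a : R, ∃ b, b ^ n = a

section RootClosed

variable {k l : Type u} [Field k] [Field l]

theorem minpoly_eq_X_pow_sub_C_of_pow_eq {p : ℕ} (hp : p.Prime) [Algebra k l] {a : k} {b : l}
    (hb : b ^ p = algebraMap k l a) (ha : ∀ c : k, c ^ p ≠ a) :
    minpoly k b = X ^ p - C a :=
  (minpoly.eq_of_irreducible_of_monic (X_pow_sub_C_irreducible_of_prime hp ha) (by simp [hb])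
    (monic_X_pow_sub_C _ hp.ne_zero)).symm

/-- Being closed under `p`-th roots descends along finite extensions. -/
theorem RootClosed.of_finiteDimensional {p : ℕ} (hp : p.Prime) [Algebra k l]
    [FiniteDimensional k l] (h : RootClosed p l) (hs : p ≠ 2 ∨ IsSquare (-1 : k)) :
    RootClosed p k := by
  induction hd : finrank k l using Nat.strong_induction_on generalizing k with
  | _ d ih =>
    subst hd
    by_contra hk
    obtain ⟨a, ha⟩ : ∃ a : k, ∀ c : k, c ^ p ≠ a := by simpa [RootClosed] using hk
    obtain ⟨b, hb⟩ := h (algebraMap k l a)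
    have hmin := minpoly_eq_X_pow_sub_C_of_pow_eq hp hb ha
    have hint : IsIntegral k b := .of_finite k b
    have hfin : finrank k k⟮b⟯ = p := by
      rw [adjoin.finrank hint, hmin, natDegree_X_pow_sub_C]
    have hmul := finrank_mul_finrank k k⟮b⟯ l
    have hlt : finrank k⟮b⟯ l < finrank k l := by
      rw [← hmul, hfin]
      exact lt_mul_of_one_lt_left finrank_pos hp.one_lt
    have hs' : p ≠ 2 ∨ IsSquare (-1 : k⟮b⟯) :=
      hs.imp_right fun h => by simpa using h.map (algebraMap k k⟮b⟯)
    -- As `c ^ p = b`, the norm of `c` to `k` has `p`-th power equal to the norm of `b`, which is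
    -- `a` for odd `p` and `-a` for `p = 2`; a square root of `-1` repairs the sign.
    obtain ⟨c, hc⟩ := ih _ hlt hs' rfl (AdjoinSimple.gen k b)
    have hnorm : Algebra.norm k (AdjoinSimple.gen k b) = (-1) ^ p * (-a) := by
      have := Algebra.PowerBasis.norm_gen_eq_coeff_zero_minpoly (adjoin.powerBasis hint)
      rw [adjoin.powerBasis_gen, adjoin.powerBasis_dim, minpoly_gen, hmin,
        natDegree_X_pow_sub_C] at this
      rw [this]
      simp [hp.ne_zero.symm]
    rw [← hc, map_pow] at hnorm
    rcases hp.eq_two_or_odd' with rfl | hodd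
    · obtain ⟨i, hi⟩ := hs.resolve_left (by simp)
      refine ha (i * Algebra.norm k c) ?_
      rw [mul_pow, hnorm, pow_two i, ← hi]
      ring
    · refine ha (Algebra.norm k c) ?_
      rw [hnorm, hodd.neg_one_pow]
      ring

/-- If `a` is not a `p`-th power, `X ^ p - a` is irreducible and yields a finite extension of `k` of
degree divisible by `p`. -/
theorem IsNClosed.rootClosed {p : ℕ} (hp : p.Prime) (h : IsNClosed p k) [Algebra k l]
    [FiniteDimensional k l] : RootClosed p l := by
  by_contra hl
  obtain ⟨a, ha⟩ : ∃ a : l, ∀ c : l, c ^ p ≠ a := by simpa [RootClosed] using hl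
  have hirr := X_pow_sub_C_irreducible_of_prime hp ha
  have : Fact (Irreducible (X ^ p - C a)) := ⟨hirr⟩
  let pb := AdjoinRoot.powerBasis hirr.ne_zero
  have hdim : finrank l (AdjoinRoot (X ^ p - C a)) = p := by
    rw [pb.finrank, AdjoinRoot.powerBasis_dim, natDegree_X_pow_sub_C]
  have : FiniteDimensional l (AdjoinRoot (X ^ p - C a)) := pb.finite
  have : FiniteDimensional k (AdjoinRoot (X ^ p - C a)) := FiniteDimensional.trans k l _
  have hc := h (AdjoinRoot (X ^ p - C a))
  rw [← finrank_mul_finrank k l, hdim] at hc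
  exact hp.one_lt.ne' ((Nat.coprime_self p).1 (Nat.Coprime.coprime_mul_left hc))

/-- A field with enough `p`-th roots of unity and closed under `p`-th roots has no Galois
extension of degree `p`. -/
theorem RootClosed.finrank_ne_of_isGalois {p : ℕ} (hp : p.Prime) (h : RootClosed p k)
    (hζ : (primitiveRoots p k).Nonempty) [Algebra k l] [FiniteDimensional k l] [IsGalois k l] :
    finrank k l ≠ p := by
  intro hfin
  have : Fact p.Prime := ⟨hp⟩
  have hcyc : IsCyclic Gal(l/k) :=
    isCyclic_of_prime_card (p := p) (by rw [IsGalois.card_aut_eq_finrank, hfin])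
  -- Kummer theory produces an irreducible `X ^ p - a`, which nevertheless has a root by hypothesis.
  obtain ⟨a, ha, -⟩ := ((isCyclic_tfae k l (by rwa [hfin])).out 0 1).1
    (show IsGalois k l ∧ IsCyclic Gal(l/k) from ⟨‹_›, hcyc⟩)
  rw [hfin] at ha
  obtain ⟨b, hb⟩ := h a
  have := degree_eq_one_of_irreducible_of_root ha (x := b) (by simp [hb])
  rw [degree_X_pow_sub_C hp.pos] at this
  exact hp.one_lt.ne' (by exact_mod_cast this)

end RootClosed

/-- A finite separable extension is contained in a finite Galois extension with given roots of
unity. -/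
theorem exists_isGalois_isPrimitiveRoot (k l : Type u) [Field k] [Field l] [Algebra k l]
    [FiniteDimensional k l] [Algebra.IsSeparable k l] (n : ℕ) (hn : (n : k) ≠ 0) :
    ∃ (N : Type u) (_ : Field N) (_ : Algebra k N) (_ : Algebra l N), IsScalarTower k l N ∧
      FiniteDimensional k N ∧ IsGalois k N ∧ ∃ ζ : N, IsPrimitiveRoot ζ n := by
  have : NeZero (n : k) := ⟨hn⟩
  have : NeZero (n : SeparableClosure k) := ⟨by
    rw [← map_natCast (algebraMap k (SeparableClosure k))]
    exact (_root_.map_ne_zero _).2 hn⟩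
  obtain ⟨ζ, hζ⟩ := HasEnoughRootsOfUnity.exists_primitiveRoot (SeparableClosure k) n
  let φ : l →ₐ[k] SeparableClosure k := IsSepClosed.lift
  let E : IntermediateField k (SeparableClosure k) := φ.fieldRange ⊔ k⟮ζ⟯
  have : FiniteDimensional k φ.fieldRange := φ.toLinearMap.finiteDimensional_range
  have : FiniteDimensional k k⟮ζ⟯ :=
    adjoin.finiteDimensional (Algebra.IsIntegral.isIntegral ζ)
  have : FiniteDimensional k E := finiteDimensional_sup _ _
  let N := normalClosure k E (SeparableClosure k)
  have hE : E ≤ N := E.le_normalClosure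
  let ψ : l →ₐ[k] N := φ.codRestrict N.toSubalgebra fun x => hE (le_sup_left (a := φ.fieldRange)
    (b := k⟮ζ⟯) ⟨x, rfl⟩)
  let : Algebra l N := ψ.toRingHom.toAlgebra
  refine ⟨N, inferInstance, inferInstance, ψ.toRingHom.toAlgebra, ?_, inferInstance, ?_,
    ⟨ζ, hE (le_sup_right (a := φ.fieldRange) (b := k⟮ζ⟯) (mem_adjoin_simple_self k ζ))⟩, ?_⟩
  · exact IsScalarTower.of_algebraMap_eq fun x => (ψ.commutes x).symm
  · exact ⟨⟩
  · exact IsPrimitiveRoot.of_map_of_injective (f := N.val) hζ N.val.injective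

/-- By Cauchy's theorem an element of order `p` in the Galois group of some `N` containing `l` and
`ζ` cuts out a fixed field `F` with `[N : F] = p`. Since `[F(ζ) : F]` divides `p` and is at most `p
- 1`, `ζ` lies in `F`, and Kummer theory contradicts the closure of `F` under `p`-th roots. -/
theorem not_dvd_finrank_of_forall_separable_rootClosed {k : Type u} [Field k] {p : ℕ}
    (hp : p.Prime) (hpk : (p : k) ≠ 0)
    (h : ∀ (l : Type u) [Field l] [Algebra k l] [FiniteDimensional k l] [Algebra.IsSeparable k l],
      RootClosed p l) (l : Type u) [Field l] [Algebra k l] [FiniteDimensional k l]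
      [Algebra.IsSeparable k l] : ¬ p ∣ finrank k l := by
  intro hdvd
  have : Fact p.Prime := ⟨hp⟩
  obtain ⟨N, _, _, _, _, _, _, ζ, hζ⟩ := exists_isGalois_isPrimitiveRoot k l p hpk
  obtain ⟨σ, hσ⟩ := exists_prime_orderOf_dvd_card' (G := Gal(N/k)) p (by
    rw [IsGalois.card_aut_eq_finrank, ← finrank_mul_finrank k l N]
    exact hdvd.mul_right _)
  let F := fixedField (Subgroup.zpowers σ)
  have hfin : finrank F N = p := by
    rw [finrank_fixedField_eq_card, Nat.card_zpowers, hσ]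
  have hmul := finrank_mul_finrank F F⟮ζ⟯ N
  have hlt : finrank F F⟮ζ⟯ < p := by
    rw [adjoin.finrank (.of_finite F ζ)]
    have hroot : aeval ζ (cyclotomic p F) = 0 := by
      have := hζ.isRoot_cyclotomic hp.pos
      rwa [IsRoot, ← map_cyclotomic p (algebraMap F N), eval_map_algebraMap] at this
    have := natDegree_le_of_dvd (minpoly.dvd F ζ hroot) (cyclotomic_ne_zero p F)
    rw [natDegree_cyclotomic, Nat.totient_prime hp] at this
    have := hp.pos
    omega
  have hone : finrank F F⟮ζ⟯ = 1 := by
    rw [hfin] at hmul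
    exact ((Nat.dvd_prime hp).1 ⟨_, hmul.symm⟩).resolve_right hlt.ne
  obtain ⟨z, hz⟩ : ∃ z : F, algebraMap F N z = ζ := by
    rw [finrank_adjoin_simple_eq_one_iff] at hone
    exact mem_bot.1 hone
  have hz' : IsPrimitiveRoot z p :=
    IsPrimitiveRoot.of_map_of_injective (f := algebraMap F N) (by rwa [hz])
      (algebraMap F N).injective
  exact (h F).finrank_ne_of_isGalois hp ⟨z, (mem_primitiveRoots hp.pos).2 hz'⟩ hfin

/-- Only the separable degree needs Kummer theory: the inseparable degree is a power of the
characteristic exponent, which is prime to `p`. -/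
theorem isNClosed_of_forall_separable_rootClosed {k : Type u} [Field k] {p : ℕ} (hp : p.Prime)
    (hpk : (p : k) ≠ 0)
    (h : ∀ (l : Type u) [Field l] [Algebra k l] [FiniteDimensional k l] [Algebra.IsSeparable k l],
      RootClosed p l) : IsNClosed p k := by
  intro l _ _ _
  rw [← Field.finSepDegree_mul_finInsepDegree k l]
  refine Nat.Coprime.mul_left ?_ ?_
  · rw [Nat.coprime_comm, hp.coprime_iff_not_dvd, Field.finSepDegree_eq]
    exact not_dvd_finrank_of_forall_separable_rootClosed hp hpk h (separableClosure k l)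
  · obtain ⟨q, hq⟩ := ExpChar.exists k
    obtain ⟨n, hn⟩ := finInsepDegree_eq_pow k l q
    rw [hn]
    refine Nat.Coprime.pow_left n ?_
    cases hq with
    | zero => exact Nat.coprime_one_left p
    | prime hq =>
      rw [Nat.coprime_primes hq hp]
      rintro rfl
      exact hpk (CharP.cast_eq_zero k q)

/-! ### Sums of squares, Artin–Schreier theory and real closures. -/

section FormallyReal

theorem FormallyReal.isSemireal {k : Type u} [Field k] (h : FormallyReal k) : IsSemireal k := by
  obtain ⟨_, _⟩ := h
  infer_instance

theorem isSumSq_map {R S : Type*} [CommRing R] [CommRing S] (f : R →+* S) {s : R}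
    (hs : IsSumSq s) : IsSumSq (f s) := by
  induction hs with
  | zero => simp [IsSumSq.zero]
  | sq_add a _ ih => simpa using IsSumSq.sq_add (f a) ih

theorem IsSemireal.of_ringHom {R S : Type*} [CommRing R] [CommRing S] (f : R →+* S)
    [IsSemireal S] : IsSemireal R where
  one_add_ne_zero hs h :=
    IsSemireal.one_add_ne_zero (isSumSq_map f hs) (by rw [← map_one f, ← map_add, h, map_zero])

theorem IsSemireal.not_isSquare_neg_one (R : Type*) [CommRing R] [IsSemireal R] :
    ¬ IsSquare (-1 : R) := fun h => IsSemireal.not_isSumSq_neg_one R h.isSumSq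

/-- Dividing the relation by a nonzero `s` gives `1 + t * s * (s⁻¹) ^ 2 = 0`, which semireality
excludes. -/
theorem IsSemireal.eq_zero_of_add_eq_zero {k : Type*} [Field k] [IsSemireal k] {s t : k}
    (hs : IsSumSq s) (ht : IsSumSq t) (h : s + t = 0) : s = 0 := by
  by_contra h0
  refine IsSemireal.one_add_ne_zero (s := t * s * (s⁻¹ * s⁻¹))
    ((ht.mul hs).mul (IsSumSq.mul_self _)) ?_
  field_simp
  rw [h, mul_zero]

/-- A field in which `-1` is not a sum of squares and every element is a square up to sign is
Euclidean. -/
theorem formallyEuclidean_of_isSemireal {k : Type u} [Field k] [IsSemireal k]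
    (h : ∀ x : k, IsSquare x ∨ IsSquare (-x)) : FormallyEuclidean k := by
  classical
  have hsum : ∀ x y : k, IsSquare x → IsSquare y → IsSquare (x + y) := by
    intro x y hx hy
    rcases h (x + y) with h1 | h1
    · exact h1
    · have : -(x + y) = 0 := IsSemireal.eq_zero_of_add_eq_zero h1.isSumSq
        (hx.isSumSq.add hy.isSumSq) (by ring)
      rw [neg_eq_zero] at this
      rw [this]
      exact IsSquare.zero
  let C : RingCone k :=
    { carrier := {x | IsSquare x}
      mul_mem' := fun hx hy => hx.mul hy
      one_mem' := IsSquare.one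
      add_mem' := fun hx hy => hsum _ _ hx hy
      zero_mem' := IsSquare.zero
      eq_zero_of_mem_of_neg_mem' := fun {x} (hx : IsSquare x) (hy : IsSquare (-x)) =>
        IsSemireal.eq_zero_of_add_eq_zero hx.isSumSq hy.isSumSq (by ring) }
  have : HasMemOrNegMem C := ⟨h⟩
  let o : LinearOrder k := LinearOrder.mkOfAddGroupCone C
  have ho : IsOrderedRing k := IsOrderedRing.mkOfCone C
  refine ⟨o, inferInstance, fun x hx => ?_⟩
  have : x - 0 ∈ C := hx
  rwa [sub_zero] at this

/-- Leading coefficients of sums of squares are again sums of squares and cannot cancel, so the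
largest of the even degrees survives. -/
theorem isSumSq_polynomial {k : Type*} [Field k] [IsSemireal k] {S : k[X]} (hS : IsSumSq S) :
    IsSumSq S.leadingCoeff ∧ Even S.natDegree := by
  induction hS with
  | zero => simp [IsSumSq.zero]
  | @sq_add a S hS ih =>
    rcases eq_or_ne a 0 with rfl | ha
    · simpa using ih
    rcases eq_or_ne S 0 with rfl | hS0
    · simp [natDegree_mul ha ha]
    have hlc : (a * a).leadingCoeff + S.leadingCoeff ≠ 0 := by
      intro h
      have := IsSemireal.eq_zero_of_add_eq_zero (by simp) ih.1 h
      simp [ha] at this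
    have haa : Even (a * a).natDegree := by simp [natDegree_mul ha ha]
    rcases lt_trichotomy (a * a).natDegree S.natDegree with h | h | h
    · rw [natDegree_add_eq_right_of_natDegree_lt h, leadingCoeff_add_of_degree_lt
        (degree_lt_degree h)]
      exact ih
    · have hd : degree (a * a) = degree S := by
        rw [degree_eq_natDegree (mul_ne_zero ha ha), degree_eq_natDegree hS0, h]
      rw [leadingCoeff_add_of_degree_eq hd hlc]
      refine ⟨(by simp : IsSumSq (a * a).leadingCoeff).add ih.1, ?_⟩
      rw [natDegree_eq_of_degree_eq ((degree_add_eq_of_leadingCoeff_add_ne_zero hlc).trans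
        (by rw [hd, max_self] : _ = S.degree))]
      exact ih.2
    · rw [natDegree_add_eq_left_of_natDegree_lt h, leadingCoeff_add_of_degree_lt'
        (degree_lt_degree h)]
      exact ⟨by simp, haa⟩

theorem exists_irreducible_dvd_odd_natDegree {k : Type*} [Field k] {g : k[X]}
    (hg : Odd g.natDegree) : ∃ h, Irreducible h ∧ h ∣ g ∧ Odd h.natDegree := by
  induction g using WfDvdMonoid.induction_on_irreducible with
  | zero => simp at hg
  | unit u hu => simp [natDegree_eq_zero_of_isUnit hu] at hg
  | mul a i ha hi ih =>
    rcases Nat.even_or_odd i.natDegree with h | h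
    · rw [natDegree_mul hi.ne_zero ha, Nat.odd_add'] at hg
      obtain ⟨q, hq, hqa, hqodd⟩ := ih (hg.2 h)
      exact ⟨q, hq, hqa.mul_left i, hqodd⟩
    · exact ⟨i, hi, dvd_mul_right _ _, h⟩

/-- Reducing each representative modulo `f` before squaring gives the degree bound on which the
descent for odd degree extensions rests. -/
theorem exists_isSumSq_lift {k : Type*} [Field k] {f : k[X]} (hf : 0 < f.natDegree)
    {s : AdjoinRoot f} (hs : IsSumSq s) :
    ∃ S : k[X], IsSumSq S ∧ AdjoinRoot.mk f S = s ∧ S.natDegree ≤ 2 * (f.natDegree - 1) := by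
  induction hs with
  | zero => exact ⟨0, .zero, by simp, by simp⟩
  | sq_add a _ ih =>
    obtain ⟨S, hS, rfl, hdeg⟩ := ih
    obtain ⟨a, rfl⟩ := AdjoinRoot.mk_surjective a
    refine ⟨(a % f) * (a % f) + S, .sq_add _ hS, ?_, ?_⟩
    · have : AdjoinRoot.mk f (a % f) = AdjoinRoot.mk f a := by
        rw [AdjoinRoot.mk_eq_mk]
        exact ⟨-(a / f), by linear_combination EuclideanDomain.div_add_mod a f⟩
      rw [map_add, map_mul, this]
    · have h1 : (a % f).natDegree < f.natDegree := natDegree_mod_lt a hf.ne'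
      refine (natDegree_add_le _ _).trans (max_le (natDegree_mul_le.trans ?_) hdeg)
      omega

/-- A simple extension of odd degree of a semireal field is semireal. -/
theorem AdjoinRoot.isSemireal_of_odd {k : Type*} [Field k] [IsSemireal k] {f : k[X]}
    (hf : Irreducible f) (hodd : Odd f.natDegree) : IsSemireal (AdjoinRoot f) := by
  induction hn : f.natDegree using Nat.strong_induction_on generalizing f with
  | _ n ih =>
    subst hn
    refine ⟨fun {s} hs h => ?_⟩
    obtain ⟨S, hS, rfl, hdeg⟩ := exists_isSumSq_lift hodd.pos hs
    have hS' : IsSumSq (1 * 1 + S) := .sq_add 1 hS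
    rw [← map_one (AdjoinRoot.mk f), ← map_add, AdjoinRoot.mk_eq_zero] at h
    obtain ⟨g, hg⟩ := h
    rw [one_mul] at hS'
    have hne : 1 + S ≠ 0 := by
      intro h0
      have := congrArg (eval 0) h0
      rw [eval_add, eval_one, eval_zero] at this
      exact IsSemireal.one_add_ne_zero (isSumSq_map (evalRingHom 0) hS) this
    have hdeg' : (1 + S).natDegree ≤ 2 * (f.natDegree - 1) :=
      (natDegree_add_le _ _).trans (by simpa using hdeg)
    have heven := (isSumSq_polynomial hS').2
    have hg0 : g ≠ 0 := by
      rintro rfl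
      exact hne (by simpa using hg)
    rw [hg, natDegree_mul hf.ne_zero hg0] at hdeg' heven
    -- Springer's descent: `1 + S = f * g` has even degree at most `2 * (deg f - 1)`, so `g` has odd
    -- degree below `deg f`, and an irreducible factor of `g` of odd degree would be a smaller
    -- counterexample.
    have hgodd : Odd g.natDegree := by
      rw [Nat.even_add'] at heven
      exact heven.1 hodd
    obtain ⟨q, hq, hqg, hqodd⟩ := exists_irreducible_dvd_odd_natDegree hgodd
    have := natDegree_le_of_dvd hqg hg0
    have hpos := hodd.pos
    have := ih _ (by omega) hq hqodd rfl
    refine IsSemireal.one_add_ne_zero (isSumSq_map (AdjoinRoot.mk q) hS) ?_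
    rw [← map_one (AdjoinRoot.mk q), ← map_add, AdjoinRoot.mk_eq_zero, hg]
    exact hqg.mul_left f

theorem IsSemireal.of_odd_finrank {k l : Type*} [Field k] [Field l] [Algebra k l] [IsSemireal k]
    (h : Odd (finrank k l)) : IsSemireal l := by
  have : FiniteDimensional k l := .of_finrank_pos h.pos
  obtain ⟨α, hα⟩ := Field.exists_primitive_element k l
  have hint : IsIntegral k α := .of_finite k α
  have hodd : Odd (minpoly k α).natDegree := by
    rwa [← adjoin.finrank hint, hα, finrank_top']
  have := AdjoinRoot.isSemireal_of_odd (minpoly.irreducible hint) hodd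
  have : IsSemireal k⟮α⟯ :=
    .of_ringHom (adjoinRootEquivAdjoin k hint).symm.toRingEquiv.toRingHom
  rw [hα] at this
  exact .of_ringHom (topEquiv (F := k) (E := l)).symm.toRingEquiv.toRingHom

/-- A semireal subfield of an algebraic extension is contained in a maximal one. -/
theorem exists_maximal_isSemireal (k Ω : Type*) [Field k] [Field Ω] [Algebra k Ω] [IsSemireal k] :
    ∃ M : IntermediateField k Ω, Maximal (fun M : IntermediateField k Ω => IsSemireal M) M := by
  have hbot : IsSemireal (⊥ : IntermediateField k Ω) :=
    .of_ringHom (botEquiv k Ω).toRingEquiv.toRingHom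
  obtain ⟨M, -, hM⟩ := zorn_le_nonempty₀ {M : IntermediateField k Ω | IsSemireal M}
    (fun c hc hchain y hy => by
      have : Nonempty c := ⟨⟨y, hy⟩⟩
      have hdir : Directed (· ≤ ·) (fun M : c => (M : IntermediateField k Ω)) :=
        hchain.directedOn.directed_val
      let U : IntermediateField k Ω := ⨆ M : c, (M : IntermediateField k Ω)
      have hle : ∀ M : c, (M : IntermediateField k Ω) ≤ U := le_iSup _
      -- A sum of squares involves finitely many elements, so one in the union of the chain already
      -- lives in a member of it.
      have key : ∀ s : U, IsSumSq s → ∃ M : c, ∃ t : (M : IntermediateField k Ω),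
          IsSumSq t ∧ inclusion (hle M) t = s := by
        intro s hs
        induction hs with
        | zero => exact ⟨⟨y, hy⟩, 0, .zero, map_zero _⟩
        | sq_add a _ ih =>
          obtain ⟨M, t, ht, rfl⟩ := ih
          have ha : (a : Ω) ∈ (U : Set Ω) := a.2
          rw [coe_iSup_of_directed hdir, Set.mem_iUnion] at ha
          obtain ⟨M', ha⟩ := ha
          obtain ⟨M'', h, h'⟩ := hdir M M'
          refine ⟨M'', ⟨a, h' ha⟩ * ⟨a, h' ha⟩ + inclusion h t,
            .sq_add _ (isSumSq_map (inclusion h).toRingHom ht), ?_⟩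
          exact Subtype.ext rfl
      refine ⟨U, ⟨fun {s} hs h => ?_⟩, fun M hM => hle ⟨M, hM⟩⟩
      obtain ⟨M, t, ht, rfl⟩ := key s hs
      have : IsSemireal (M : IntermediateField k Ω) := hc M.2
      refine IsSemireal.one_add_ne_zero ht ((inclusion (hle M)).toRingHom.injective ?_)
      rw [map_add, map_one]
      exact h.trans (map_zero (inclusion (hle M)).toRingHom).symm) ⊥ hbot
  exact ⟨M, hM⟩

theorem exists_eq_add_mul_of_mem_adjoin {F R : Type*} [CommRing F] [CommRing R] [Algebra F R]
    {d : F} {j : R} (hj : j ^ 2 = algebraMap F R d) {x : R} (hx : x ∈ Algebra.adjoin F {j}) :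
    ∃ a b : F, x = algebraMap F R a + algebraMap F R b * j := by
  induction hx using Algebra.adjoin_induction with
  | mem x hx => exact ⟨0, 1, by simpa using hx⟩
  | algebraMap r => exact ⟨r, 0, by simp⟩
  | add x y _ _ hx hy =>
    obtain ⟨a, b, rfl⟩ := hx
    obtain ⟨c, e, rfl⟩ := hy
    exact ⟨a + c, b + e, by simp only [map_add]; ring⟩
  | mul x y _ _ hx hy =>
    obtain ⟨a, b, rfl⟩ := hx
    obtain ⟨c, e, rfl⟩ := hy
    refine ⟨a * c + b * e * d, a * e + b * c, ?_⟩
    simp only [map_add, map_mul, ← hj]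
    ring

section Maximal

variable {k Ω : Type*} [Field k] [Field Ω] [Algebra k Ω] [IsAlgClosed Ω] {M : IntermediateField k Ω}

/-- The image of an `M`-embedding of `N` into `Ω` is a semireal field containing `M`, hence equal to
`M`. -/
theorem algebraMap_surjective_of_maximal_isSemireal
    (hM : Maximal (fun M : IntermediateField k Ω => IsSemireal M) M)
    {N : Type*} [Field N] [IsSemireal N] [Algebra M N] [FiniteDimensional M N] :
    Function.Surjective (algebraMap M N) := by
  have : Module.IsTorsionFree M N := inferInstance
  have : FaithfulSMul M Ω := inferInstance
  have : Module.IsTorsionFree M Ω := FaithfulSMul.to_isTorsionFree M Ω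
  let φ : N →ₐ[M] Ω := IsAlgClosed.lift
  let M' : IntermediateField k Ω := φ.fieldRange.restrictScalars k
  have hsemi : IsSemireal M' :=
    .of_ringHom (AlgEquiv.ofInjectiveField φ).symm.toRingEquiv.toRingHom
  have hle : M ≤ M' := fun x hx => ⟨algebraMap M N ⟨x, hx⟩, φ.commutes _⟩
  intro y
  have hy : φ y ∈ M := hM.2 hsemi hle ⟨y, rfl⟩
  exact ⟨⟨φ y, hy⟩, φ.injective (φ.commutes _)⟩

theorem exists_isRoot_of_maximal_isSemireal
    (hM : Maximal (fun M : IntermediateField k Ω => IsSemireal M) M) {h : M[X]}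
    (hirr : Irreducible h) (hs : IsSemireal (AdjoinRoot h)) : ∃ x, h.IsRoot x := by
  have : Fact (Irreducible h) := ⟨hirr⟩
  have : FiniteDimensional M (AdjoinRoot h) := (AdjoinRoot.powerBasis hirr.ne_zero).finite
  obtain ⟨x, hx⟩ := algebraMap_surjective_of_maximal_isSemireal hM (AdjoinRoot.root h)
  refine ⟨x, (algebraMap M (AdjoinRoot h)).injective ?_⟩
  rw [map_zero, ← AdjoinRoot.eval₂_root h, ← hx]
  exact (eval₂_at_apply _ _).symm

/-- If `x` is not a square, `M(√x)` is not semireal. Expanding `-1` as a sum of squares there gives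
`-1 = A + x B + c √x` with `A`, `B` sums of squares. As `√x ∉ M`, `c = 0`, and `-x = (1 + A) / B` is
a sum of squares. -/
theorem isSquare_or_isSumSq_neg_of_maximal_isSemireal
    (hM : Maximal (fun M : IntermediateField k Ω => IsSemireal M) M) (x : M) :
    IsSquare x ∨ IsSumSq (-x) := by
  have := hM.prop
  refine or_iff_not_imp_left.2 fun hx => ?_
  have hx' : ∀ c : M, c ^ 2 ≠ x := fun c hc => hx ⟨c, by rw [← hc, sq]⟩
  have hirr := X_pow_sub_C_irreducible_of_prime Nat.prime_two hx'
  have : Fact (Irreducible (X ^ 2 - C x)) := ⟨hirr⟩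
  have hns : ¬ IsSemireal (AdjoinRoot (X ^ 2 - C x)) := by
    intro hs
    obtain ⟨c, hc⟩ := exists_isRoot_of_maximal_isSemireal hM hirr hs
    exact hx' c (by simpa [sub_eq_zero] using hc)
  have hj : AdjoinRoot.root (X ^ 2 - C x) ^ 2 = algebraMap M _ x := by
    have := AdjoinRoot.eval₂_root (X ^ 2 - C x)
    simpa [sub_eq_zero] using this
  have key : ∀ s : AdjoinRoot (X ^ 2 - C x), IsSumSq s → ∃ A B c : M, IsSumSq A ∧ IsSumSq B ∧
      s = algebraMap M _ (A + x * B) + algebraMap M _ c * AdjoinRoot.root (X ^ 2 - C x) := by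
    intro s hs
    induction hs with
    | zero => exact ⟨0, 0, 0, .zero, .zero, by simp⟩
    | sq_add a _ ih =>
      obtain ⟨A, B, c, hA, hB, rfl⟩ := ih
      obtain ⟨u, w, rfl⟩ := exists_eq_add_mul_of_mem_adjoin hj
        (x := a) (by rw [AdjoinRoot.adjoinRoot_eq_top]; trivial)
      refine ⟨u * u + A, w * w + B, 2 * u * w + c, .sq_add _ hA, .sq_add _ hB, ?_⟩
      simp only [map_add, map_mul, map_ofNat, ← hj]
      ring
  rw [isSemireal_iff_not_isSumSq_neg_one, not_not] at hns
  obtain ⟨A, B, c, hA, hB, h⟩ := key _ hns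
  have hc : c = 0 := by
    by_contra hc
    refine hx' (-(1 + A + x * B) / c) ((algebraMap M (AdjoinRoot (X ^ 2 - C x))).injective ?_)
    rw [← hj, map_pow]
    congr 1
    rw [map_div₀, div_eq_iff (by simpa using hc)]
    simp only [map_neg, map_add, map_one] at h ⊢
    linear_combination h
  subst hc
  have h' : -1 = A + x * B := (algebraMap M (AdjoinRoot (X ^ 2 - C x))).injective (by simpa using h)
  have hB0 : B ≠ 0 := by
    rintro rfl
    exact IsSemireal.one_add_ne_zero hA (by linear_combination -h')
  have hxe : -x = (1 * 1 + A) * B * (B⁻¹ * B⁻¹) := by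
    field_simp
    linear_combination h'
  rw [hxe]
  exact ((IsSumSq.sq_add 1 hA).mul hB).mul (.mul_self _)

/-- Sums of squares are squares, since `x` and `-x` can both be sums of squares only for `x = 0`. An
irreducible factor of odd degree has a semireal root field, so by maximality it has a root. -/
theorem isRealClosed_of_maximal_isSemireal
    (hM : Maximal (fun M : IntermediateField k Ω => IsSemireal M) M) : IsRealClosed M := by
  have := hM.prop
  have hsq : ∀ x : M, IsSumSq x → IsSquare x := fun x hx =>
    (isSquare_or_isSumSq_neg_of_maximal_isSemireal hM x).elim id fun h => by
      rw [IsSemireal.eq_zero_of_add_eq_zero hx h (by ring)]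
      exact IsSquare.zero
  exact
    { isSquare_or_isSquare_neg := fun x =>
        (isSquare_or_isSumSq_neg_of_maximal_isSemireal hM x).imp_right (hsq _)
      exists_isRoot_of_odd_natDegree := fun {f} hf => by
        obtain ⟨h, hirr, hdvd, hodd⟩ := exists_irreducible_dvd_odd_natDegree hf
        obtain ⟨x, hx⟩ := exists_isRoot_of_maximal_isSemireal hM hirr
          (AdjoinRoot.isSemireal_of_odd hirr hodd)
        exact ⟨x, hx.dvd hdvd⟩ }

end Maximal

theorem exists_isRealClosureOf (k : Type u) [Field k] [IsSemireal k] :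
    ∃ (R : Type u) (_ : Field R) (_ : Algebra k R), IsRealClosureOf k R := by
  obtain ⟨M, hM⟩ := exists_maximal_isSemireal k (AlgebraicClosure k)
  exact ⟨M, inferInstance, inferInstance, isRealClosed_of_maximal_isSemireal hM, inferInstance⟩

/-- A real closure is ordered by its squares, and this order restricts to `k`. -/
theorem IsSemireal.formallyReal (k : Type u) [Field k] [IsSemireal k] : FormallyReal k := by
  obtain ⟨R, _, _, hR⟩ := exists_isRealClosureOf k
  have := hR.isRealClosed
  obtain ⟨_, _, -⟩ := formallyEuclidean_of_isSemireal (k := R)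
    IsRealClosed.isSquare_or_isSquare_neg
  let o : LinearOrder k := LinearOrder.lift' (algebraMap k R) (algebraMap k R).injective
  exact ⟨o, Function.Injective.isStrictOrderedRing (algebraMap k R) (map_zero _) (map_one _)
    (map_add _) (map_mul _) Iff.rfl Iff.rfl⟩

end FormallyReal

/-! ### Euclidean fields and quadratic closure after adjoining `√-1`. -/

section Euclidean

theorem IsPrimitiveRoot.sq_eq_neg_one {R : Type*} [CommRing R] [IsDomain R] {i : R}
    (h : IsPrimitiveRoot i 4) : i ^ 2 = -1 := by
  have h4 : (i ^ 2 - 1) * (i ^ 2 + 1) = 0 := by linear_combination h.pow_eq_one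
  rcases mul_eq_zero.1 h4 with h2 | h2
  · exact absurd (sub_eq_zero.1 h2) (h.pow_ne_one_of_pos_of_lt (by norm_num) (by norm_num))
  · exact eq_neg_of_add_eq_zero_left h2

theorem exists_eq_add_mul_of_adjoin_simple {F N : Type*} [Field F] [Field N] [Algebra F N] {i : N}
    (hi : i ^ 2 = -1) (x : F⟮i⟯) :
    ∃ a b : F, x = algebraMap F F⟮i⟯ a + algebraMap F F⟮i⟯ b * AdjoinSimple.gen F i := by
  have hint : IsIntegral F i := ⟨X ^ 2 - C (-1), monic_X_pow_sub_C _ two_ne_zero, by simp [hi]⟩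
  have hx : (x : N) ∈ Algebra.adjoin F {i} := by
    rw [← adjoin_simple_toSubalgebra_of_isAlgebraic hint.isAlgebraic]
    exact x.2
  obtain ⟨a, b, h⟩ := exists_eq_add_mul_of_mem_adjoin (d := (-1 : F)) (by simpa using hi) hx
  exact ⟨a, b, Subtype.ext h⟩

theorem gen_sq_eq_neg_one {F N : Type*} [Field F] [Field N] [Algebra F N] {i : N}
    (hi : i ^ 2 = -1) : AdjoinSimple.gen F i ^ 2 = -1 := Subtype.ext hi

theorem finrank_adjoin_simple_of_sq_eq_neg_one {F N : Type u} [Field F] [Field N] [Algebra F N]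
    {i : N} (hi : i ^ 2 = -1) (hF : ¬ IsSquare (-1 : F)) : finrank F F⟮i⟯ = 2 := by
  have hmin : minpoly F i = X ^ 2 - C (-1) :=
    minpoly_eq_X_pow_sub_C_of_pow_eq Nat.prime_two (by simpa using hi)
      fun c hc => hF ⟨c, by rw [← hc, sq]⟩
  have hint : IsIntegral F i := ⟨X ^ 2 - C (-1), monic_X_pow_sub_C _ two_ne_zero, by simp [hi]⟩
  rw [adjoin.finrank hint, hmin, natDegree_X_pow_sub_C]

/-- The extension of a Euclidean field by a square root of `-1` is quadratically closed. -/
theorem FormallyEuclidean.rootClosed_adjoin {F N : Type u} [Field F] [Field N] [Algebra F N]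
    (h : FormallyEuclidean F) {i : N} (hi : i ^ 2 = -1) : RootClosed 2 F⟮i⟯ := by
  obtain ⟨_, _, h⟩ := h
  intro x
  obtain ⟨a, b, rfl⟩ := exists_eq_add_mul_of_adjoin_simple hi x
  set j := AdjoinSimple.gen F i with hj
  have hj2 : j ^ 2 = -1 := gen_sq_eq_neg_one hi
  -- The formula for a complex square root: with `n = √(a² + b²)`, the two coordinates are square
  -- roots of `(n + a) / 2` and `(n - a) / 2`, with relative sign chosen according to `2uw = ±b`.
  obtain ⟨n, hn0, hn⟩ : ∃ n : F, 0 ≤ n ∧ n ^ 2 = a ^ 2 + b ^ 2 := by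
    obtain ⟨n, hn⟩ := h (a ^ 2 + b ^ 2) (by positivity)
    exact ⟨|n|, abs_nonneg n, by rw [sq_abs, hn, sq n]⟩
  have han : |a| ≤ n := abs_le_of_sq_le_sq (by rw [hn]; nlinarith [sq_nonneg b]) hn0
  obtain ⟨u, hu⟩ := h ((n + a) / 2) (by linarith [neg_abs_le a])
  obtain ⟨w, hw⟩ := h ((n - a) / 2) (by linarith [le_abs_self a])
  have hprod : (2 * u * w - b) * (2 * u * w + b) = 0 := by
    have : (2 * u * w - b) * (2 * u * w + b) = 4 * (u * u) * (w * w) - b ^ 2 := by ring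
    rw [this, ← hu, ← hw]
    linear_combination hn
  have hA : a = u * u - w * w := by rw [← hu, ← hw]; ring
  rcases mul_eq_zero.1 hprod with hb | hb
  · refine ⟨algebraMap F _ u + algebraMap F _ w * j, ?_⟩
    rw [← sub_eq_zero.1 hb, hA]
    simp only [map_sub, map_mul, map_ofNat]
    linear_combination (algebraMap F F⟮i⟯ w) ^ 2 * hj2
  · refine ⟨algebraMap F _ u - algebraMap F _ w * j, ?_⟩
    rw [show b = -(2 * u * w) by linear_combination hb, hA]
    simp only [map_sub, map_mul, map_ofNat, map_neg]
    linear_combination (algebraMap F F⟮i⟯ w) ^ 2 * hj2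

/-- A quadratically closed field has no Galois extension whose degree is a nontrivial power
of `2`. -/
theorem RootClosed.finrank_eq_one_of_two_pow {E N : Type u} [Field E] [Field N] [Algebra E N]
    [FiniteDimensional E N] [IsGalois E N] (h2 : (2 : E) ≠ 0) (h : RootClosed 2 E) {m : ℕ}
    (hm : finrank E N = 2 ^ m) : finrank E N = 1 := by
  rcases m with _ | m
  · simpa using hm
  exfalso
  have : Fact (Nat.Prime 2) := ⟨Nat.prime_two⟩
  have hcard : Nat.card Gal(N/E) = 2 ^ (m + 1) := by rw [IsGalois.card_aut_eq_finrank, hm]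
  -- A nontrivial `2`-group has a subgroup of index `2`, whose fixed field is a forbidden quadratic
  -- extension.
  obtain ⟨H, hH⟩ := Sylow.exists_subgroup_card_pow_prime (G := Gal(N/E)) 2 (n := m)
    (by rw [hcard]; exact pow_dvd_pow 2 (Nat.le_succ m))
  have hidx : H.index = 2 := by
    have := H.card_mul_index
    rw [hH, hcard, pow_succ] at this
    exact Nat.eq_of_mul_eq_mul_left (by positivity) this
  have : H.Normal := Subgroup.normal_of_index_eq_two hidx
  have hfin : finrank E (fixedField H) = 2 := by
    have := finrank_mul_finrank E (fixedField H) N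
    rw [finrank_fixedField_eq_card, hH, hm, pow_succ, mul_comm] at this
    exact Nat.eq_of_mul_eq_mul_left (by positivity) this
  have hprim : (primitiveRoots 2 E).Nonempty := by
    refine ⟨-1, (mem_primitiveRoots two_pos).2 ?_⟩
    obtain ⟨q, hq⟩ := CharP.exists E
    refine IsPrimitiveRoot.neg_one q ?_
    rintro rfl
    exact h2 (CharP.cast_eq_zero E 2)
  exact h.finrank_ne_of_isGalois Nat.prime_two hprim (l := fixedField H) hfin

theorem HereditarilyEuclidean.isSemireal {k : Type u} [Field k] (h : HereditarilyEuclidean k) :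
    IsSemireal k := h.1.isSemireal

/-- The fixed field `F` of a Sylow `2`-subgroup has odd degree over `k`, so it stays real and is
Euclidean. Then `F(i)` is quadratically closed while `N / F(i)` has `2`-power degree, so `N = F(i)`
and `[N : k]` is twice an odd number. -/
theorem HereditarilyEuclidean.not_four_dvd_finrank {k N : Type u} [Field k] [Field N] [Algebra k N]
    [FiniteDimensional k N] [IsGalois k N] (h : HereditarilyEuclidean k) {i : N}
    (hi : i ^ 2 = -1) : ¬ 4 ∣ finrank k N := by
  have := h.isSemireal
  have : Fact (Nat.Prime 2) := ⟨Nat.prime_two⟩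
  obtain ⟨P⟩ : Nonempty (Sylow 2 Gal(N/k)) := inferInstance
  let F := fixedField (P : Subgroup Gal(N/k))
  have hFN : finrank F N = Nat.card P := finrank_fixedField_eq_card _
  have hmul := finrank_mul_finrank k F N
  have hodd : Odd (finrank k F) := by
    have h1 := (P : Subgroup Gal(N/k)).card_mul_index
    rw [IsGalois.card_aut_eq_finrank, ← hmul, hFN, mul_comm] at h1
    have h2 := Nat.eq_of_mul_eq_mul_right Nat.card_pos h1
    rw [← h2, ← Nat.not_even_iff_odd, even_iff_two_dvd]
    exact P.not_dvd_index
  have hF : IsSemireal F := .of_odd_finrank hodd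
  have hE := h.2 F (IsSemireal.formallyReal F)
  have hquad : finrank F F⟮i⟯ = 2 :=
    finrank_adjoin_simple_of_sq_eq_neg_one hi (IsSemireal.not_isSquare_neg_one F)
  have hmul' := finrank_mul_finrank F F⟮i⟯ N
  obtain ⟨m, hm⟩ : ∃ m, finrank F⟮i⟯ N = 2 ^ m := by
    obtain ⟨n, hn⟩ := IsPGroup.iff_card.1 P.isPGroup'
    have hn' : finrank F⟮i⟯ N ∣ 2 ^ n := ⟨2, by rw [← hn, ← hFN, ← hmul', hquad, mul_comm]⟩
    obtain ⟨m, -, hm⟩ := (Nat.dvd_prime_pow Nat.prime_two).1 hn'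
    exact ⟨m, hm⟩
  have hone : finrank F⟮i⟯ N = 1 :=
    (hE.rootClosed_adjoin hi).finrank_eq_one_of_two_pow two_ne_zero hm
  rw [← hmul, ← hmul', hquad, hone]
  rintro ⟨c, hc⟩
  obtain ⟨d, hd⟩ := hodd
  omega

/-- A finite extension of a hereditarily Euclidean field which is not formally real is
quadratically closed. -/
theorem HereditarilyEuclidean.rootClosed {k l : Type u} [Field k] [Field l] [Algebra k l]
    [FiniteDimensional k l] (h : HereditarilyEuclidean k) (hl : ¬ FormallyReal l) :
    RootClosed 2 l := by
  have := h.isSemireal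
  by_contra hr
  obtain ⟨a, ha⟩ : ∃ a : l, ∀ c : l, c ^ 2 ≠ a := by simpa [RootClosed] using hr
  have hirr := X_pow_sub_C_irreducible_of_prime Nat.prime_two ha
  have : Fact (Irreducible (X ^ 2 - C a)) := ⟨hirr⟩
  let pb := AdjoinRoot.powerBasis hirr.ne_zero
  have hdim : finrank l (AdjoinRoot (X ^ 2 - C a)) = 2 := by
    rw [pb.finrank, AdjoinRoot.powerBasis_dim, natDegree_X_pow_sub_C]
  have : FiniteDimensional l (AdjoinRoot (X ^ 2 - C a)) := pb.finite
  have : FiniteDimensional k (AdjoinRoot (X ^ 2 - C a)) := FiniteDimensional.trans k l _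
  obtain ⟨N, _, _, _, _, _, _, i, hi⟩ :=
    exists_isGalois_isPrimitiveRoot k (AdjoinRoot (X ^ 2 - C a)) 4 (by norm_num)
  refine h.not_four_dvd_finrank hi.sq_eq_neg_one ?_
  -- Extensions of odd degree stay real, so `[l : k]` is even, and the quadratic extension of `l`
  -- contributes the second factor `2`.
  have heven : Even (finrank k l) := by
    rw [← Nat.not_odd_iff_even]
    intro hodd
    have := IsSemireal.of_odd_finrank hodd
    exact hl (IsSemireal.formallyReal l)
  obtain ⟨c, hc⟩ := heven
  rw [← finrank_mul_finrank k (AdjoinRoot (X ^ 2 - C a)) N, ← finrank_mul_finrank k l, hdim, hc]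
  exact ⟨c * finrank (AdjoinRoot (X ^ 2 - C a)) N, by ring⟩

/-- Every finite separable extension containing a square root of `-1` is quadratically closed. -/
def QuadraticallyClosedOverI (k : Type u) [Field k] : Prop :=
  ∀ (l : Type u) [Field l] [Algebra k l] [FiniteDimensional k l] [Algebra.IsSeparable k l],
    IsSquare (-1 : l) → RootClosed 2 l

namespace QuadraticallyClosedOverI

variable {k l : Type u} [Field k] [Field l] [Algebra k l]

theorem isNClosed (h : QuadraticallyClosedOverI k) (h2 : (2 : k) ≠ 0) [FiniteDimensional k l]
    [Algebra.IsSeparable k l] (hl : IsSquare (-1 : l)) : IsNClosed 2 l := by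
  refine isNClosed_of_forall_separable_rootClosed Nat.prime_two ?_ fun m _ _ _ _ => ?_
  · rw [Nat.cast_ofNat, ← map_ofNat (algebraMap k l)]
    exact (_root_.map_ne_zero _).2 h2
  · let : Algebra k m := ((algebraMap l m).comp (algebraMap k l)).toAlgebra
    have : IsScalarTower k l m := .of_algebraMap_eq fun _ => rfl
    have : FiniteDimensional k m := FiniteDimensional.trans k l m
    have : Algebra.IsSeparable k m := Algebra.IsSeparable.trans k l m
    exact h m (by simpa using hl.map (algebraMap l m))

theorem rootClosed_adjoin (h : QuadraticallyClosedOverI k) [FiniteDimensional k l]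
    [Algebra.IsSeparable k l] (h2 : (2 : k) ≠ 0) :
    ∃ (N : Type u) (_ : Field N) (_ : Algebra l N) (i : N), i ^ 2 = -1 ∧ RootClosed 2 l⟮i⟯ := by
  have h4 : ((4 : ℕ) : l) ≠ 0 := by
    rw [show (4 : ℕ) = 2 * 2 by norm_num, Nat.cast_mul, Nat.cast_ofNat,
      ← map_ofNat (algebraMap k l)]
    exact mul_ne_zero ((_root_.map_ne_zero _).2 h2) ((_root_.map_ne_zero _).2 h2)
  obtain ⟨N, _, _, hfd, hsep, i, hi⟩ : ∃ (N : Type u) (_ : Field N) (_ : Algebra l N),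
      FiniteDimensional l N ∧ Algebra.IsSeparable l N ∧ ∃ i : N, IsPrimitiveRoot i 4 := by
    obtain ⟨N, fN, aN, -, -, hfd, hgal, i, hi⟩ := exists_isGalois_isPrimitiveRoot l l 4 h4
    exact ⟨N, fN, aN, hfd, hgal.to_isSeparable, i, hi⟩
  refine ⟨N, _, ‹_›, i, hi.sq_eq_neg_one, ?_⟩
  let : Algebra k l⟮i⟯ := ((algebraMap l l⟮i⟯).comp (algebraMap k l)).toAlgebra
  have : IsScalarTower k l l⟮i⟯ := .of_algebraMap_eq fun _ => rfl
  have : FiniteDimensional k l⟮i⟯ := FiniteDimensional.trans k l _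
  have : Algebra.IsSeparable k l⟮i⟯ := Algebra.IsSeparable.trans k l _
  exact h _ ⟨AdjoinSimple.gen l i, by rw [← sq, gen_sq_eq_neg_one hi.sq_eq_neg_one]⟩

/-- Every `x + y i` in `l(i)` is some `(u + w i) ^ 2`, so `x = u² - w²` and `y = 2uw`. For `y = 0`
this makes `x` or `-x` a square; for `a + b i` it gives `a² + b² = (u² + w²)²`, so sums of squares
are squares. -/
theorem isSquare_or_isSquare_neg_and_isSemireal (h : QuadraticallyClosedOverI k)
    (h2 : (2 : k) ≠ 0) [FiniteDimensional k l] [Algebra.IsSeparable k l]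
    (hl : ¬ IsSquare (-1 : l)) : (∀ a : l, IsSquare a ∨ IsSquare (-a)) ∧ IsSemireal l := by
  obtain ⟨N, _, _, i, hi, hr⟩ := h.rootClosed_adjoin (l := l) h2
  set j := AdjoinSimple.gen l i
  have hj2 : j ^ 2 = -1 := gen_sq_eq_neg_one hi
  have hl2 : (2 : l) ≠ 0 := by
    rw [← map_ofNat (algebraMap k l)]
    exact (_root_.map_ne_zero _).2 h2
  have hinj : ∀ a b : l, algebraMap l l⟮i⟯ a + algebraMap l l⟮i⟯ b * j = 0 → a = 0 ∧ b = 0 := by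
    intro a b hab
    have hb : b = 0 := by
      by_contra hb
      refine hl ⟨a / b, (algebraMap l l⟮i⟯).injective ?_⟩
      have hb' : algebraMap l l⟮i⟯ b ≠ 0 := by simpa using hb
      rw [map_neg, map_one, map_mul, map_div₀, ← hj2]
      field_simp
      linear_combination (algebraMap l l⟮i⟯ b * j - algebraMap l l⟮i⟯ a) * hab
    subst hb
    exact ⟨by simpa using hab, rfl⟩
  have hroot : ∀ x y : l, ∃ u w : l, x = u * u - w * w ∧ y = 2 * u * w := by
    intro x y
    obtain ⟨z, hz⟩ := hr (algebraMap l _ x + algebraMap l _ y * j)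
    obtain ⟨u, w, rfl⟩ := exists_eq_add_mul_of_adjoin_simple hi z
    obtain ⟨h1, h3⟩ := hinj (u * u - w * w - x) (2 * u * w - y) (by
      simp only [map_sub, map_mul, map_ofNat]
      linear_combination hz - (algebraMap l l⟮i⟯ w) ^ 2 * hj2)
    exact ⟨u, w, by linear_combination -h1, by linear_combination -h3⟩
  refine ⟨fun a => ?_, ?_⟩
  · obtain ⟨u, w, ha, h0⟩ := hroot a 0
    rcases mul_eq_zero.1 h0.symm with h0 | rfl
    · obtain rfl := (mul_eq_zero.1 h0).resolve_left hl2
      exact .inr ⟨w, by linear_combination -ha⟩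
    · exact .inl ⟨u, by linear_combination ha⟩
  · have hsq : ∀ s : l, IsSumSq s → IsSquare s := by
      intro s hs
      induction hs with
      | zero => exact IsSquare.zero
      | sq_add a _ ih =>
        obtain ⟨b, rfl⟩ := ih
        obtain ⟨u, w, rfl, rfl⟩ := hroot a b
        exact ⟨u * u + w * w, by ring⟩
    rw [isSemireal_iff_not_isSumSq_neg_one]
    exact fun hs => hl (hsq _ hs)

theorem isSemireal (h : QuadraticallyClosedOverI k) (h2 : (2 : k) ≠ 0)
    (hk : ¬ IsSquare (-1 : k)) : IsSemireal k :=
  (h.isSquare_or_isSquare_neg_and_isSemireal (l := k) h2 hk).2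

/-- An element of a real algebraic extension generates a finite real one, which lacks `√-1`, so the
element is a square up to sign. -/
theorem hereditarilyEuclidean (h : QuadraticallyClosedOverI k) (h2 : (2 : k) ≠ 0)
    (hk : ¬ IsSquare (-1 : k)) : HereditarilyEuclidean k := by
  have := h.isSemireal h2 hk
  refine ⟨IsSemireal.formallyReal k, fun l _ _ _ hl => ?_⟩
  have := hl.isSemireal
  refine formallyEuclidean_of_isSemireal fun a => ?_
  have hfin : FiniteDimensional k k⟮a⟯ := adjoin.finiteDimensional (Algebra.IsIntegral.isIntegral a)
  have hsemi : IsSemireal k⟮a⟯ := .of_ringHom (algebraMap k⟮a⟯ l)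
  exact ((h.isSquare_or_isSquare_neg_and_isSemireal (l := k⟮a⟯) h2
    (IsSemireal.not_isSquare_neg_one _)).1 (AdjoinSimple.gen k a)).imp
      (fun h => h.map (algebraMap k⟮a⟯ l)) fun h => by simpa using h.map (algebraMap k⟮a⟯ l)

/-- Let `N` be Galois over `k` and contain `l` and `i`. Since `k(i)` is `2`-closed, `[N : k]` is
twice an odd number. If `i ∉ l`, that single factor `2` is used up by `l(i) / l`, so `[l : k]` is
odd. -/
theorem even_finrank_iff (h : QuadraticallyClosedOverI k) (h2 : (2 : k) ≠ 0)
    (hk : ¬ IsSquare (-1 : k)) [FiniteDimensional k l] :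
    Even (finrank k l) ↔ IsSquare (-1 : l) := by
  have := h.isSemireal h2 hk
  constructor
  · intro heven
    by_contra hl
    obtain ⟨N, _, _, _, _, _, _, i, hi⟩ := exists_isGalois_isPrimitiveRoot k l 4 (by norm_num)
    have hi2 := hi.sq_eq_neg_one
    have h1 := finrank_adjoin_simple_of_sq_eq_neg_one (F := k) hi2 hk
    have h3 := finrank_adjoin_simple_of_sq_eq_neg_one (F := l) hi2 hl
    have hc : IsNClosed 2 k⟮i⟯ :=
      h.isNClosed h2 ⟨AdjoinSimple.gen k i, by rw [← sq, gen_sq_eq_neg_one hi2]⟩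
    have hodd : Odd (finrank k⟮i⟯ N) := Nat.coprime_two_right.1 (hc N)
    have h4 := finrank_mul_finrank k k⟮i⟯ N
    rw [← finrank_mul_finrank k l N, ← finrank_mul_finrank l l⟮i⟯ N, h1, h3] at h4
    obtain ⟨c, hc⟩ := heven
    obtain ⟨d, hd⟩ := hodd
    have h5 : 2 * (2 * d + 1) = 4 * (c * finrank l⟮i⟯ N) := by rw [← hd, h4, hc]; ring
    omega
  · rintro ⟨i, hi⟩
    have h1 := finrank_adjoin_simple_of_sq_eq_neg_one (F := k) (i := i) (by rw [hi, sq]) hk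
    rw [← finrank_mul_finrank k k⟮i⟯ l, h1]
    exact even_two.mul_right _

end QuadraticallyClosedOverI

end Euclidean

/-! ### Closed points of affine curves and Noether normalization. -/

section Charts

open IsDedekindDomain

variable {k A : Type u} [Field k] [CommRing A] [Algebra k A]

/-- By lying over, a nonzero prime of `R` is the contraction of a nonzero, hence maximal, prime of
`A`; contraction along an integral map preserves maximality. -/
theorem isMaximal_of_isPrime_of_injective_isIntegral {R : Type*} [CommRing R] [IsDomain A]
    [Ring.DimensionLEOne A] {g : R →+* A} (hg : Function.Injective g) (hi : g.IsIntegral)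
    {Q : Ideal R} (hQ : Q.IsPrime) (hQ0 : Q ≠ ⊥) : Q.IsMaximal := by
  algebraize [g]
  have : Algebra.IsIntegral R A := ⟨hi⟩
  obtain ⟨P, -, hP, hPQ⟩ := Ideal.exists_ideal_over_prime_of_isIntegral Q (⊥ : Ideal A) (by
    rw [← RingHom.ker_eq_comap_bot, (RingHom.injective_iff_ker_eq_bot (algebraMap R A)).1 hg]
    exact bot_le)
  have hP0 : P ≠ ⊥ := by
    rintro rfl
    refine hQ0 ?_
    rw [← hPQ, ← RingHom.ker_eq_comap_bot, (RingHom.injective_iff_ker_eq_bot (algebraMap R A)).1 hg]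
  have := hP.isMaximal hP0
  rw [← hPQ]
  exact Ideal.isMaximal_comap_of_isIntegral_of_isMaximal P

/-- Noether normalization in dimension one. -/
theorem exists_finite_injective_polynomial [IsDomain A] [Ring.DimensionLEOne A]
    [Algebra.FiniteType k A] (hA : ¬ IsField A) :
    ∃ g : k[X] →ₐ[k] A, Function.Injective g ∧ g.Finite := by
  obtain ⟨s, g, hg, hf⟩ := exists_finite_inj_algHom_of_fg k A
  -- Without variables, `A` would be integral over a field and hence a field. With at least two,
  -- killing the first variable and sending the others to `X` has a nonzero prime kernel that is not
  -- maximal.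
  have hs : s = 1 := by
    rcases s with _ | _ | s
    · exfalso
      let e : MvPolynomial (Fin 0) k ≃ₐ[k] k := MvPolynomial.isEmptyAlgEquiv k (Fin 0)
      have hF : IsField (MvPolynomial (Fin 0) k) := e.toMulEquiv.isField (Field.toIsField k)
      algebraize [g.toRingHom]
      have : Algebra.IsIntegral (MvPolynomial (Fin 0) k) A := ⟨hf.to_isIntegral⟩
      exact hA (isField_of_isIntegral_of_isField' hF)
    · rfl
    · exfalso
      let φ : MvPolynomial (Fin (s + 2)) k →ₐ[k] k[X] :=
        MvPolynomial.aeval fun i => if i = 0 then 0 else X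
      have hφ : Function.Surjective φ := by
        intro q
        refine ⟨aeval (MvPolynomial.X 1) q, ?_⟩
        rw [← aeval_algHom_apply]
        simp [φ]
      have hmax : (RingHom.ker φ).IsMaximal := by
        refine isMaximal_of_isPrime_of_injective_isIntegral (g := g.toRingHom) hg
          hf.to_isIntegral (RingHom.ker_isPrime _) fun h => ?_
        have h0 : (MvPolynomial.X 0 : MvPolynomial (Fin (s + 2)) k) ∈ RingHom.ker φ := by
          simp [φ, RingHom.mem_ker]
        rw [h, Ideal.mem_bot] at h0
        exact MvPolynomial.X_ne_zero _ h0
      have hF := (Ideal.Quotient.maximal_ideal_iff_isField_quotient _).1 hmax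
      exact Polynomial.not_isField k
        ((Ideal.quotientKerAlgEquivOfSurjective hφ).symm.toMulEquiv.isField hF)
  subst hs
  let e : k[X] ≃ₐ[k] MvPolynomial (Fin 1) k :=
    ((MvPolynomial.uniqueAlgEquiv k (Fin 1))).symm
  exact ⟨g.comp e.toAlgHom, hg.comp e.injective,
    RingHom.Finite.comp hf (RingHom.Finite.of_surjective _ e.surjective)⟩

instance finiteDimensional_quotient [IsDedekindDomain A] [Algebra.FiniteType k A]
    (P : HeightOneSpectrum A) :
    FiniteDimensional k (A ⧸ P.asIdeal) := by
  let := Ideal.Quotient.field P.asIdeal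
  exact finite_of_finite_type_of_isJacobsonRing k (A ⧸ P.asIdeal)

theorem exists_heightOneSpectrum_mem {g : k[X] →ₐ[k] A} (hg : Function.Injective g)
    (hf : g.Finite) {q : k[X]} (hq : Irreducible q) :
    ∃ P : HeightOneSpectrum A, g q ∈ P.asIdeal := by
  algebraize [g.toRingHom]
  have : Algebra.IsIntegral k[X] A := ⟨hf.to_isIntegral⟩
  have : (Ideal.span {q}).IsMaximal := PrincipalIdealRing.isMaximal_of_irreducible hq
  obtain ⟨P, hP, hPq⟩ := Ideal.exists_ideal_over_maximal_of_isIntegral (S := A) (Ideal.span {q}) (by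
    rw [(RingHom.injective_iff_ker_eq_bot (algebraMap k[X] A)).1 hg]
    exact bot_le)
  have hmem : g q ∈ P := by
    have : q ∈ P.comap (algebraMap k[X] A) := hPq ▸ Ideal.mem_span_singleton_self q
    exact this
  refine ⟨⟨P, hP.isPrime, fun h => hq.ne_zero (hg ?_)⟩, hmem⟩
  rw [h] at hmem
  rw [map_zero]
  exact hmem

theorem nonempty_algHom_of_aeval_minpoly_eq_zero {l B : Type*} [Field l] [Algebra k l]
    [FiniteDimensional k l] [CommRing B] [Algebra k B] {β : l} (hβ : k⟮β⟯ = ⊤) {b : B}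
    (hb : aeval b (minpoly k β) = 0) : Nonempty (l →ₐ[k] B) := by
  let pb := adjoin.powerBasis (Algebra.IsIntegral.isIntegral (R := k) β)
  have hgen : minpoly k pb.gen = minpoly k β := by
    rw [adjoin.powerBasis_gen, minpoly_gen]
  exact ⟨(pb.lift b (by rw [hgen, hb])).comp
    ((topEquiv.symm.trans (equivOfEq hβ.symm)) : l ≃ₐ[k] k⟮β⟯).toAlgHom⟩

/-- Lying over gives a closed point where `g (minpoly k β)` vanishes; there the class of `g X` is a
root of the minimal polynomial, to which `β` can be sent. -/
theorem exists_aeval_eq_zero_algHom {g : k[X] →ₐ[k] A} (hg : Function.Injective g)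
    (hf : g.Finite) {l : Type*} [Field l] [Algebra k l] [FiniteDimensional k l] {β : l}
    (hβ : k⟮β⟯ = ⊤) :
    ∃ P : HeightOneSpectrum A, g (minpoly k β) ∈ P.asIdeal ∧ Nonempty (l →ₐ[k] A ⧸ P.asIdeal) := by
  obtain ⟨P, hP⟩ := exists_heightOneSpectrum_mem hg hf
    (minpoly.irreducible (Algebra.IsIntegral.isIntegral (R := k) β))
  refine ⟨P, hP, nonempty_algHom_of_aeval_minpoly_eq_zero hβ
    (b := Ideal.Quotient.mkₐ k P.asIdeal (g X)) ?_⟩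
  rw [aeval_algHom_apply, aeval_algHom_apply, aeval_X_left_apply, Ideal.Quotient.mkₐ_eq_mk,
    Ideal.Quotient.eq_zero_iff_mem]
  exact hP

theorem infinite_setOf_nonempty_algHom [IsDedekindDomain A] [Algebra.FiniteType k A]
    (hA : ¬ IsField A) (l : Type*) [Field l] [Algebra k l]
    [FiniteDimensional k l] [Algebra.IsSeparable k l] :
    {P : HeightOneSpectrum A | Nonempty (l →ₐ[k] A ⧸ P.asIdeal)}.Infinite := by
  obtain ⟨g, hg, hf⟩ := exists_finite_injective_polynomial (k := k) hA
  rcases finite_or_infinite k with hk | hk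
  · intro hfin
    have hq (P : HeightOneSpectrum A) : Finite (A ⧸ P.asIdeal) := Module.finite_of_finite k
    -- Finite `k`: finitely many residue fields have bounded size, but the construction applies
    -- equally to an extension of `l` with more than `N` elements.
    obtain ⟨N, hN⟩ := (hfin.image fun P => Nat.card (A ⧸ P.asIdeal)).bddAbove
    let Ω := AlgebraicClosure l
    obtain ⟨S, hS⟩ := Infinite.exists_subset_card_eq Ω (N + 1)
    let m := IntermediateField.adjoin l (S : Set Ω)
    have : FiniteDimensional l m :=
      finiteDimensional_adjoin fun x _ => Algebra.IsIntegral.isIntegral x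
    have : FiniteDimensional k m := FiniteDimensional.trans k l m
    have : Finite m := Module.finite_of_finite k
    obtain ⟨β, hβ⟩ := Field.exists_primitive_element k m
    obtain ⟨P, -, ⟨φ⟩⟩ := exists_aeval_eq_zero_algHom hg hf hβ
    have h1 : Nat.card (A ⧸ P.asIdeal) ≤ N :=
      hN ⟨P, ⟨φ.comp (IsScalarTower.toAlgHom k l m)⟩, rfl⟩
    have := P.isPrime.ne_top
    have : Nontrivial (A ⧸ P.asIdeal) := Ideal.Quotient.nontrivial_iff.2 P.isPrime.ne_top
    have h2 : Nat.card m ≤ Nat.card (A ⧸ P.asIdeal) :=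
      Nat.card_le_card_of_injective φ φ.toRingHom.injective
    have h3 : S.card ≤ Nat.card m := by
      rw [← Nat.card_eq_finsetCard]
      exact Nat.card_mono (Set.toFinite (m : Set Ω)) (subset_adjoin l (S : Set Ω))
    omega
  · obtain ⟨β, hβ⟩ := Field.exists_primitive_element k l
    -- Infinite `k`: every translate `β + c` is primitive. If infinitely many `c` gave the same
    -- point, their minimal polynomials would agree, since distinct ones are coprime, and one
    -- polynomial would have infinitely many roots `β + c`.
    have hβc (c : k) : k⟮β + algebraMap k l c⟯ = ⊤ := by
      rw [eq_top_iff, ← hβ, adjoin_simple_le_iff]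
      simpa using sub_mem (mem_adjoin_simple_self k (β + algebraMap k l c))
        (IntermediateField.algebraMap_mem _ c)
    choose P hP hPl using fun c => exists_aeval_eq_zero_algHom hg hf (hβc c)
    intro hfin
    have := hfin.to_subtype
    obtain ⟨⟨Q, hQl⟩, hQ⟩ := Finite.exists_infinite_fiber
      fun c : k => (⟨P c, hPl c⟩ : {P : HeightOneSpectrum A | Nonempty (l →ₐ[k] A ⧸ P.asIdeal)})
    have hmin : ∀ c c' : k, P c = Q → P c' = Q →
        minpoly k (β + algebraMap k l c) = minpoly k (β + algebraMap k l c') := by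
      intro c c' hc hc'
      have hirr (d : k) := minpoly.irreducible
        (Algebra.IsIntegral.isIntegral (R := k) (β + algebraMap k l d))
      refine eq_of_monic_of_associated (minpoly.monic (Algebra.IsIntegral.isIntegral _))
        (minpoly.monic (Algebra.IsIntegral.isIntegral _)) ((hirr c).associated_of_dvd (hirr c') ?_)
      by_contra hdvd
      obtain ⟨x, y, hxy⟩ := (hirr c).coprime_iff_not_dvd.2 hdvd
      refine Q.isPrime.ne_top ((Ideal.eq_top_iff_one _).2 ?_)
      rw [← map_one g, ← hxy, map_add, map_mul, map_mul]
      exact add_mem (Ideal.mul_mem_left _ _ (hc ▸ hP c)) (Ideal.mul_mem_left _ _ (hc' ▸ hP c'))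
    obtain ⟨c₀, hc₀⟩ := hQ.nonempty
    have hPc {c : k} (hc : c ∈ (fun c : k => (⟨P c, hPl c⟩ :
        {P : HeightOneSpectrum A | Nonempty (l →ₐ[k] A ⧸ P.asIdeal)})) ⁻¹' {⟨Q, hQl⟩}) :
        P c = Q := congrArg Subtype.val hc
    refine Set.infinite_coe_iff.1 hQ (Set.Finite.subset (Set.Finite.preimage (f := fun c : k =>
      β + algebraMap k l c) (fun c _ c' _ h => (algebraMap k l).injective (add_left_cancel h))
      (rootSet_finite (minpoly k (β + algebraMap k l c₀)) l)) fun c hc => ?_)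
    rw [Set.mem_preimage, mem_rootSet, hmin c₀ c (hPc hc₀) (hPc hc)]
    exact ⟨minpoly.ne_zero (Algebra.IsIntegral.isIntegral _), minpoly.aeval _ _⟩

/-- If almost all residue fields are closed under `p`-th roots, then so are all finite separable
extensions of the constant field (up to adjoining `√-1` when `p = 2`). -/
theorem isNClosed_or_quadraticallyClosedOverI [IsDedekindDomain A] [Algebra.FiniteType k A]
    (hA : ¬ IsField A) {p : ℕ} (hp : p.Prime) (hpk : (p : k) ≠ 0)
    (h : {P : HeightOneSpectrum A | ¬ RootClosed p (A ⧸ P.asIdeal)}.Finite) :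
    IsNClosed p k ∨ p = 2 ∧ QuadraticallyClosedOverI k := by
  have key (l : Type u) [Field l] [Algebra k l] [FiniteDimensional k l] [Algebra.IsSeparable k l]
      (hl : p ≠ 2 ∨ IsSquare (-1 : l)) : RootClosed p l := by
    -- Among the infinitely many residue fields containing `l`, one avoids the finite exceptional
    -- set; its closure under roots then descends to `l`.
    obtain ⟨P, ⟨φ⟩, hP⟩ := ((infinite_setOf_nonempty_algHom (k := k) hA l).sdiff h).nonempty
    rw [Set.mem_ofPred_eq, not_not] at hP
    let := Ideal.Quotient.field P.asIdeal
    let : Algebra l (A ⧸ P.asIdeal) := φ.toRingHom.toAlgebra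
    have : IsScalarTower k l (A ⧸ P.asIdeal) := .of_algebraMap_eq fun x => (φ.commutes x).symm
    have : FiniteDimensional l (A ⧸ P.asIdeal) := FiniteDimensional.right k l _
    exact RootClosed.of_finiteDimensional hp hP hl
  by_cases hp2 : p = 2
  · subst hp2
    exact .inr ⟨rfl, fun l _ _ _ _ hl => key l (.inr hl)⟩
  · exact .inl (isNClosed_of_forall_separable_rootClosed hp hpk fun l _ _ _ _ => key l (.inl hp2))

end Charts

/-! ### Perturbing finite maps to the affine line. -/

section Perturbation

variable {k A : Type u} [Field k] [CommRing A] [Algebra k A]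

theorem Polynomial.monic_eval₂_of_natDegree_coeff_lt {R S : Type*} [CommRing R] [CommRing S]
    [Nontrivial S] (φ : R →+* S[X]) {H : R[X]} (hH : H.Monic) {w : S[X]} (hw : w.Monic)
    (hlt : ∀ j, (φ (H.coeff j)).natDegree < w.natDegree) : (H.eval₂ φ w).Monic := by
  rw [eval₂_eq_sum_range, Finset.sum_range_succ, hH.coeff_natDegree, map_one, one_mul]
  refine Monic.add_of_right (hw.pow _) ?_
  rw [degree_eq_natDegree (hw.pow _).ne_zero, hw.natDegree_pow]
  refine (degree_sum_le _ _).trans_lt ((Finset.sup_lt_iff (WithBot.bot_lt_coe _)).2 fun j hj => ?_)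
  refine (degree_le_natDegree).trans_lt (Nat.cast_lt.2 (natDegree_mul_le.trans_lt ?_))
  rw [hw.natDegree_pow]
  have h1 := Finset.mem_range.1 hj
  have h2 := hlt j
  nlinarith

/-- Let `H` be a monic equation of `-h` over `k[t]` and `f = h + q(t) ^ N`, so that `q(t) ^ N - f =
-h`. Substituting `q(Y) ^ N - f` into `H`, with its coefficients read as polynomials in `Y`, gives
an equation of `t` over `k[f]`. It is monic once `N * deg q` exceeds the degrees of these
coefficients; integrality of `A` over `k[f]` follows by transitivity. -/
theorem exists_isIntegral_perturbation {t : A} (ht : (aeval t : k[X] →ₐ[k] A).toRingHom.IsIntegral)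
    {q : k[X]} (hq : q.Monic) (hq1 : 0 < q.natDegree) (h : A) :
    ∃ N : ℕ, 0 < N ∧ (aeval (h + aeval t q ^ N) : k[X] →ₐ[k] A).toRingHom.IsIntegral := by
  obtain ⟨H, hH, hHh⟩ := ht (-h)
  obtain ⟨D, hD⟩ : ∃ D, ∀ j, (H.coeff j).natDegree ≤ D :=
    ⟨H.support.sup fun j => (H.coeff j).natDegree, fun j => by
      by_cases hj : j ∈ H.support
      · exact Finset.le_sup (f := fun j => (H.coeff j).natDegree) hj
      · simp [notMem_support_iff.1 hj]⟩
  refine ⟨D + 1, D.succ_pos, ?_⟩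
  set f := h + aeval t q ^ (D + 1) with hf
  algebraize [(aeval f : k[X] →ₐ[k] A).toRingHom]
  have halg : ∀ x : k[X], algebraMap k[X] A x = aeval f x := fun _ => rfl
  let w : k[X][X] := q.map C ^ (D + 1) - C X
  have hqm : (q.map (C : k →+* k[X])).Monic := hq.map _
  have hdeg : (q.map (C : k →+* k[X]) ^ (D + 1)).natDegree = (D + 1) * q.natDegree := by
    rw [hqm.natDegree_pow, natDegree_map_eq_of_injective C_injective]
  have hlt : D < (D + 1) * q.natDegree := by nlinarith
  have hw : w.Monic := (hqm.pow _).sub_of_left (by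
    rw [degree_eq_natDegree (hqm.pow _).ne_zero, hdeg]
    exact degree_C_le.trans_lt (Nat.cast_pos.2 (by omega)))
  have hwd : w.natDegree = (D + 1) * q.natDegree := by
    rw [natDegree_sub_C, hdeg]
  have htint : IsIntegral k[X] t := by
    refine ⟨H.eval₂ (mapRingHom C) w, monic_eval₂_of_natDegree_coeff_lt _ hH hw fun j => ?_, ?_⟩
    · rw [hwd, coe_mapRingHom, natDegree_map_eq_of_injective C_injective]
      exact (hD j).trans_lt hlt
    · rw [← coe_eval₂RingHom, hom_eval₂]
      have h1 : (eval₂RingHom (algebraMap k[X] A) t).comp (mapRingHom C) =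
          (aeval t : k[X] →ₐ[k] A).toRingHom := by
        ext x
        · simp [halg]
        · simp
      have h2 : eval₂RingHom (algebraMap k[X] A) t w = -h := by
        have h3 : eval₂ (algebraMap k[X] A) t (q.map C) = aeval t q := by
          rw [eval₂_map, aeval_def]
          congr 1
          ext x
          simp [halg]
        simp only [w, map_sub, map_pow, coe_eval₂RingHom, h3, eval₂_C, halg, aeval_X, hf]
        ring
      rw [h1, h2, hHh]
  let S := integralClosure k[X] A
  have hS (x : k[X]) : aeval t x ∈ S := by
    rw [aeval_eq_sum_range]
    refine sum_mem fun i _ => ?_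
    rw [Algebra.smul_def]
    refine mul_mem ?_ (pow_mem htint i)
    have : algebraMap k A (x.coeff i) = algebraMap k[X] A (C (x.coeff i)) := by simp [halg]
    rw [this]
    exact S.algebraMap_mem _
  let g' : k[X] →+* S := (aeval t : k[X] →ₐ[k] A).toRingHom.codRestrict S hS
  intro a
  obtain ⟨P, hP, hPa⟩ := ht a
  have hSa : IsIntegral S a := by
    refine ⟨P.map g', hP.map g', ?_⟩
    rw [eval₂_map]
    exact hPa
  have : Algebra.IsIntegral k[X] S := inferInstance
  exact isIntegral_trans (R := k[X]) a hSa

end Perturbation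

/-! ### Closed points of odd degree on affine curves. -/

section RealPoints

open IsDedekindDomain

variable {k A : Type u} [Field k] [CommRing A] [Algebra k A]

/-- A nonzero kernel would be maximal in `k[X]`, making `A` integral over a field and hence a field.
-/
theorem injective_aeval_of_isIntegral [IsDomain A] (hA : ¬ IsField A) {f : A}
    (hf : (aeval f : k[X] →ₐ[k] A).toRingHom.IsIntegral) :
    Function.Injective (aeval f : k[X] →ₐ[k] A) := by
  rw [RingHom.injective_iff_ker_eq_bot]
  by_contra hker
  have hprime : (RingHom.ker (aeval f : k[X] →ₐ[k] A)).IsPrime := RingHom.ker_isPrime _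
  have hmax := hprime.isMaximal hker
  let φ : k[X] ⧸ RingHom.ker (aeval f : k[X] →ₐ[k] A) →+* A :=
    RingHom.kerLift (aeval f : k[X] →ₐ[k] A).toRingHom
  have hφ : φ.IsIntegral := RingHom.IsIntegral.tower_top (Ideal.Quotient.mk _) φ hf
  have hF : IsField (k[X] ⧸ RingHom.ker (aeval f : k[X] →ₐ[k] A)) :=
    (Ideal.Quotient.maximal_ideal_iff_isField_quotient _).1 hmax
  let := φ.toAlgebra
  have : Algebra.IsIntegral (k[X] ⧸ RingHom.ker (aeval f : k[X] →ₐ[k] A)) A := ⟨hφ⟩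
  exact hA (isField_of_isIntegral_of_isField' hF)

section Fibre

variable [IsDedekindDomain A] [Algebra k[X] A] [IsScalarTower k k[X] A] [Module.Finite k[X] A]
  [FaithfulSMul k[X] A]

/-- The fibre of a finite map to the affine line over a rational point, counted with
multiplicities. -/
theorem sum_ramificationIdx_mul_finrank (c : k)
    [Fintype ((Ideal.span {X - C c} : Ideal k[X]).primesOver A)] :
    ∑ q : (Ideal.span {X - C c} : Ideal k[X]).primesOver A,
      q.1.ramificationIdx k[X] * finrank k (A ⧸ q.1) = finrank k[X] A := by
  have hmax : (Ideal.span {X - C c} : Ideal k[X]).IsMaximal :=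
    PrincipalIdealRing.isMaximal_of_irreducible (irreducible_X_sub_C c)
  have : Module.IsTorsionFree k[X] A := FaithfulSMul.to_isTorsionFree k[X] A
  rw [← Ideal.sum_ramification_inertia_eq_finrank (Ideal.span {X - C c} : Ideal k[X]) A]
  refine Finset.sum_congr rfl fun q _ => ?_
  have hq0 : q.1 ≠ ⊥ := Ideal.ne_bot_of_mem_primesOver
    (by simpa using X_sub_C_ne_zero c) q.2
  have hqmax : q.1.IsMaximal := q.2.1.isMaximal hq0
  rw [Ideal.inertiaDeg_eq_of_isMaximal (Ideal.span {X - C c}) q.1]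
  let := Ideal.Quotient.field (Ideal.span {X - C c} : Ideal k[X])
  have h1 : finrank k (k[X] ⧸ Ideal.span {X - C c}) = 1 := by
    rw [finrank_quotient_span_eq_natDegree, natDegree_X_sub_C]
  rw [← finrank_mul_finrank k (k[X] ⧸ Ideal.span {X - C c}) (A ⧸ q.1), h1, one_mul]

/-- The degree is the sum of ramification index times residue degree over the fibre, so some summand
is odd. -/
theorem exists_odd_finrank_of_odd_finrank (h : Odd (finrank k[X] A)) (c : k) :
    ∃ P : HeightOneSpectrum A, algebraMap k[X] A (X - C c) ∈ P.asIdeal ∧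
      Odd (finrank k (A ⧸ P.asIdeal)) := by
  have hmax : (Ideal.span {X - C c} : Ideal k[X]).IsMaximal :=
    PrincipalIdealRing.isMaximal_of_irreducible (irreducible_X_sub_C c)
  have : Fintype ((Ideal.span {X - C c} : Ideal k[X]).primesOver A) :=
    (Algebra.QuasiFinite.finite_primesOver _).fintype
  rw [← sum_ramificationIdx_mul_finrank c] at h
  obtain ⟨q, hq⟩ : ∃ q : (Ideal.span {X - C c} : Ideal k[X]).primesOver A,
      Odd (q.1.ramificationIdx k[X] * finrank k (A ⧸ q.1)) := by
    by_contra! hall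
    exact Nat.not_even_iff_odd.2 h (Finset.even_sum _ fun q _ => Nat.not_odd_iff_even.1 (hall q))
  refine ⟨⟨q.1, q.2.1, Ideal.ne_bot_of_mem_primesOver (by simpa using X_sub_C_ne_zero c) q.2⟩, ?_,
    (Nat.odd_mul.1 hq).2⟩
  have := q.2.2.over ▸ Ideal.mem_span_singleton_self (X - C c)
  exact this

/-- The simple zero at `P` has ramification index `1` and contributes an odd summand; all other
points over `0` contribute even ones. -/
theorem odd_finrank_of_fibre_eq {P : HeightOneSpectrum A}
    (hP : algebraMap k[X] A X ∈ P.asIdeal) (hP2 : algebraMap k[X] A X ∉ P.asIdeal ^ 2)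
    (hodd : Odd (finrank k (A ⧸ P.asIdeal)))
    (hne : ∀ Q : HeightOneSpectrum A, algebraMap k[X] A X ∈ Q.asIdeal → Q ≠ P →
      Even (finrank k (A ⧸ Q.asIdeal))) : Odd (finrank k[X] A) := by
  classical
  have hmax : (Ideal.span {X - C 0} : Ideal k[X]).IsMaximal :=
    PrincipalIdealRing.isMaximal_of_irreducible (irreducible_X_sub_C 0)
  have : Fintype ((Ideal.span {X - C 0} : Ideal k[X]).primesOver A) :=
    (Algebra.QuasiFinite.finite_primesOver _).fintype
  have : P.asIdeal.LiesOver (Ideal.span {X - C 0} : Ideal k[X]) := ⟨by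
    refine hmax.eq_of_le (P.isPrime.under k[X]).ne_top ?_
    rw [Ideal.span_singleton_le_iff_mem, C_0, sub_zero]
    exact hP⟩
  let q₀ : (Ideal.span {X - C 0} : Ideal k[X]).primesOver A := ⟨P.asIdeal, P.isPrime, this⟩
  rw [← sum_ramificationIdx_mul_finrank (k := k) (A := A) 0,
    ← Finset.add_sum_erase _ _ (Finset.mem_univ q₀)]
  refine Odd.add_even ?_ (Finset.even_sum _ fun q hq => ?_)
  · have hX : algebraMap k[X] A X ≠ 0 := fun h => X_ne_zero
      (FaithfulSMul.algebraMap_injective k[X] A (h.trans (map_zero _).symm))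
    have he : q₀.1.ramificationIdx k[X] = 1 := by
      have hmap : (Ideal.span {X - C (0 : k)}).map (algebraMap k[X] A) =
          Ideal.span {algebraMap k[X] A X} := by
        rw [Ideal.map_span, Set.image_singleton, C_0, sub_zero]
      rw [Ideal.IsDedekindDomain.ramificationIdx_eq_multiplicity (Ideal.span {X - C 0}) q₀.1
        (by rw [hmap]; simp [hX]), hmap]
      refine multiplicity_eq_of_dvd_of_not_dvd ?_ ?_
      · rw [pow_one, Ideal.dvd_span_singleton]
        exact hP
      · rw [Ideal.dvd_span_singleton]
        exact hP2
    rw [he, one_mul]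
    exact hodd
  · refine Even.mul_left (hne ⟨q.1, q.2.1, Ideal.ne_bot_of_mem_primesOver
      (by simp) q.2⟩ ?_ fun h => ?_) _
    · have h1 := q.2.2.over ▸ Ideal.mem_span_singleton_self (X - C (0 : k))
      have h2 : algebraMap k[X] A (X - C (0 : k)) ∈ q.1 := h1
      simpa only [C_0, sub_zero] using h2
    · exact (Finset.mem_erase.1 hq).1 (Subtype.ext (congrArg HeightOneSpectrum.asIdeal h))

end Fibre

variable [IsDedekindDomain A] [Algebra.FiniteType k A]

/-- Given a closed point `P` in a finite set of closed points of an affine curve, there is a finite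
map to the affine line with a simple zero at `P` and no other zero in the set. -/
theorem exists_finite_aeval_simple_zero (hA : ¬ IsField A) {B : Set (HeightOneSpectrum A)}
    (hB : B.Finite) {P : HeightOneSpectrum A} (hP : P ∈ B) :
    ∃ f : A, (aeval f : k[X] →ₐ[k] A).Finite ∧ f ∈ P.asIdeal ∧ f ∉ P.asIdeal ^ 2 ∧
      ∀ Q ∈ B, Q ≠ P → f ∉ Q.asIdeal := by
  classical
  obtain ⟨g, hg, hgf⟩ := exists_finite_injective_polynomial (k := k) hA
  have hgt : g = aeval (g X) := by ext; simp
  have ht : (aeval (g X) : k[X] →ₐ[k] A).toRingHom.IsIntegral := by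
    rw [← hgt]
    exact hgf.to_isIntegral
  obtain ⟨π, hπ, hπ2⟩ : ∃ π ∈ P.asIdeal, π ∉ P.asIdeal ^ 2 := SetLike.exists_of_lt
    (Ideal.pow_lt_self P.asIdeal P.ne_bot P.isPrime.ne_top 2 le_rfl)
  obtain ⟨h, hh⟩ := IsDedekindDomain.exists_forall_sub_mem_ideal (s := hB.toFinset)
    (fun Q : HeightOneSpectrum A => Q.asIdeal) (fun _ => 2) (fun Q _ => Q.prime)
    (fun Q _ Q' _ hne heq => hne (HeightOneSpectrum.ext heq))
    (fun Q => if Q.1 = P then π else 1)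
  -- By the Chinese remainder theorem `h` is `π` modulo `P ^ 2` and `1` modulo the other `Q ^ 2`.
  -- Since `q(t)` vanishes to order at least two on `B`, adding a power of it to `h` keeps these
  -- conditions while making the map finite.
  let q : k[X] := ∏ Q ∈ hB.toFinset, minpoly k (Ideal.Quotient.mkₐ k Q.asIdeal (g X)) ^ 2
  have hint (Q : HeightOneSpectrum A) : IsIntegral k (Ideal.Quotient.mkₐ k Q.asIdeal (g X)) :=
    Algebra.IsIntegral.isIntegral _
  have hqm : q.Monic := monic_prod_of_monic _ _ fun Q _ => (minpoly.monic (hint Q)).pow 2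
  have hdvd (Q) (hQ : Q ∈ B) : minpoly k (Ideal.Quotient.mkₐ k Q.asIdeal (g X)) ^ 2 ∣ q :=
    Finset.dvd_prod_of_mem (fun Q : HeightOneSpectrum A =>
      minpoly k (Ideal.Quotient.mkₐ k Q.asIdeal (g X)) ^ 2) (hB.mem_toFinset.2 hQ)
  have hq1 : 0 < q.natDegree := by
    refine lt_of_lt_of_le ?_ (natDegree_le_of_dvd (hdvd P hP) hqm.ne_zero)
    have := P.isPrime.ne_top
    have : Nontrivial (A ⧸ P.asIdeal) := Ideal.Quotient.nontrivial_iff.2 this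
    rw [natDegree_pow]
    exact mul_pos two_pos (minpoly.natDegree_pos (hint P))
  have hqQ (Q) (hQ : Q ∈ B) : aeval (g X) q ∈ Q.asIdeal ^ 2 := by
    have h1 : aeval (g X) (minpoly k (Ideal.Quotient.mkₐ k Q.asIdeal (g X))) ∈ Q.asIdeal := by
      rw [← Ideal.Quotient.eq_zero_iff_mem, ← Ideal.Quotient.mkₐ_eq_mk k, ← aeval_algHom_apply,
        minpoly.aeval]
    obtain ⟨r, hr⟩ := hdvd Q hQ
    rw [hr, map_mul, map_pow]
    exact Ideal.mul_mem_right _ _ (Ideal.pow_mem_pow h1 2)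
  obtain ⟨N, hN, hf⟩ := exists_isIntegral_perturbation ht hqm hq1 h
  have hqN (Q) (hQ : Q ∈ B) : aeval (g X) q ^ N ∈ Q.asIdeal ^ 2 :=
    Ideal.pow_mem_of_mem _ (hqQ Q hQ) N hN
  have hle (Q : HeightOneSpectrum A) : Q.asIdeal ^ 2 ≤ Q.asIdeal := Ideal.pow_le_self two_ne_zero
  have hhP : h - π ∈ P.asIdeal ^ 2 := by simpa using hh P (hB.mem_toFinset.2 hP)
  refine ⟨h + aeval (g X) q ^ N, ?_, ?_, ?_, ?_⟩
  · refine hf.to_finite (RingHom.FiniteType.of_comp_finiteType (f := algebraMap k k[X]) ?_)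
    have : ((aeval (h + aeval (g X) q ^ N) : k[X] →ₐ[k] A).toRingHom).comp (algebraMap k k[X]) =
        algebraMap k A := (aeval (h + aeval (g X) q ^ N) : k[X] →ₐ[k] A).comp_algebraMap
    rw [this]
    exact RingHom.finiteType_algebraMap.2 inferInstance
  · have := add_mem (add_mem (hle P hhP) hπ) (hle P (hqN P hP))
    simpa using this
  · intro hmem
    refine hπ2 ?_
    have := sub_mem (sub_mem hmem (hqN P hP)) hhP
    simpa using this
  · intro Q hQ hne hmem
    refine Q.isPrime.ne_top ((Ideal.eq_top_iff_one _).2 ?_)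
    have h1 : h - 1 ∈ Q.asIdeal ^ 2 := by simpa [hne] using hh Q (hB.mem_toFinset.2 hQ)
    have := sub_mem (sub_mem hmem (hle Q (hqN Q hQ))) (hle Q h1)
    simpa using this

/-- If some residue field of an affine curve does not contain `√-1`, then infinitely many do not. -/
theorem QuadraticallyClosedOverI.infinite_setOf_not_isSquare_neg_one (hA : ¬ IsField A)
    (h : QuadraticallyClosedOverI k) (h2 : (2 : k) ≠ 0) (hk : ¬ IsSquare (-1 : k))
    {P : HeightOneSpectrum A} (hP : ¬ IsSquare (-1 : A ⧸ P.asIdeal)) :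
    {P : HeightOneSpectrum A | ¬ IsSquare (-1 : A ⧸ P.asIdeal)}.Infinite := by
  intro hfin
  have := h.isSemireal h2 hk
  have heven (Q : HeightOneSpectrum A) :
      Even (finrank k (A ⧸ Q.asIdeal)) ↔ IsSquare (-1 : A ⧸ Q.asIdeal) := by
    let := Ideal.Quotient.field Q.asIdeal
    exact h.even_finrank_iff h2 hk
  -- Were the set finite, it could serve as the set to be avoided: all zeros of `f` other than `P`
  -- then have even degree, the map has odd degree, and the fibres over the elements of the infinite
  -- field `k` supply infinitely many points of odd degree.
  obtain ⟨f, hf, hfP, hfP2, hfQ⟩ := exists_finite_aeval_simple_zero (k := k) hA hfin hP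
  have hinj := injective_aeval_of_isIntegral hA (k := k) (f := f) hf.to_isIntegral
  let : Algebra k[X] A := (aeval f : k[X] →ₐ[k] A).toRingHom.toAlgebra
  have : IsScalarTower k k[X] A := .of_algebraMap_eq fun x => by
    rw [RingHom.algebraMap_toAlgebra]
    exact ((aeval f : k[X] →ₐ[k] A).commutes x).symm
  have : Module.Finite k[X] A := hf
  have : FaithfulSMul k[X] A := (faithfulSMul_iff_algebraMap_injective k[X] A).2 hinj
  have halg (x : k[X]) : algebraMap k[X] A x = aeval f x := rfl
  have hodd : Odd (finrank k[X] A) := by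
    refine odd_finrank_of_fibre_eq (k := k) (P := P) (by rwa [halg, aeval_X])
      (by rwa [halg, aeval_X]) (Nat.not_even_iff_odd.1 ((heven P).not.2 hP)) fun Q hQ hne => ?_
    rw [heven]
    by_contra hsq
    rw [halg, aeval_X] at hQ
    exact hfQ Q hsq hne hQ
  choose Q hQ hQodd using exists_odd_finrank_of_odd_finrank (k := k) (A := A) hodd
  refine Set.infinite_of_injective_forall_mem (f := Q) (fun c c' hc => ?_)
    (fun c => (heven (Q c)).not.1 (Nat.not_even_iff_odd.2 (hQodd c))) hfin
  by_contra hne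
  refine (Q c).isPrime.ne_top ((Ideal.eq_top_iff_one _).2 ?_)
  have h1 : algebraMap k A (c' - c) ∈ (Q c).asIdeal := by
    have := sub_mem (hQ c) (hc ▸ hQ c')
    simpa [halg] using this
  have h3 := Ideal.mul_mem_left _ (algebraMap k A (c' - c)⁻¹) h1
  rwa [← map_mul, inv_mul_cancel₀ (sub_ne_zero.2 (Ne.symm hne)), map_one] at h3

end RealPoints

/-! ### Dedekind domains and valuations centred on them. -/

section DedekindAlgebra

open IsLocalRing IsDedekindDomain

/-- A regular Noetherian domain of dimension at most one is a Dedekind domain. -/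
theorem isDedekindDomain_of_isRegularLocalRing {A : Type*} [CommRing A] [IsDomain A]
    [IsNoetherianRing A] (hdim : ringKrullDim A ≤ 1)
    (hreg : ∀ (P : Ideal A) [P.IsPrime], IsRegularLocalRing (Localization.AtPrime P)) :
    IsDedekindDomain A := by
  have : IsDedekindDomainDvr A :=
    { is_dvr_at_nonzero_prime := fun P hP hprime => by
        have := hreg P
        have hF := IsLocalization.AtPrime.not_isField A hP (Localization.AtPrime P)
        have hd : ringKrullDim (Localization.AtPrime P) ≤ 1 := by
          rw [IsLocalization.AtPrime.ringKrullDim_eq_height P]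
          exact (Ideal.height_le_ringKrullDim_of_isPrime).trans hdim
        refine ((IsDiscreteValuationRing.TFAE (Localization.AtPrime P) hF).out 0 5).2 ?_
        -- Regularity equates the cotangent dimension with the Krull dimension, which is at most
        -- `1`; dimension `0` would make the localization a field.
        refine le_antisymm ?_ ?_
        · have h := (IsRegularLocalRing.iff_finrank_cotangentSpace (Localization.AtPrime P)).1 this
          rw [← h] at hd
          exact_mod_cast hd
        · by_contra! h
          have := finrank_cotangentSpace_eq_zero_iff.1 (Nat.lt_one_iff.1 h)
          exact hF this }
  infer_instance

variable {A K : Type*} [CommRing A] [IsDedekindDomain A] [Field K] [Algebra A K]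
  [IsFractionRing A K]

/-- A valuation centred at a maximal ideal `P` of a Dedekind domain has residue field `A ⧸ P`. -/
theorem IsDedekindDomain.HeightOneSpectrum.exists_valuation_sub_lt_one (P : HeightOneSpectrum A)
    {v : Valuation K ℤᵐ⁰} (hle : ∀ a, v (algebraMap A K a) ≤ 1)
    (hlt : ∀ a, v (algebraMap A K a) < 1 ↔ a ∈ P.asIdeal) {x : K} (hx : v x ≤ 1) :
    ∃ a, v (x - algebraMap A K a) < 1 := by
  let S := Localization.subalgebra.ofField K P.asIdeal.primeCompl
    P.asIdeal.primeCompl_le_nonZeroDivisors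
  have : IsLocalization.AtPrime S P.asIdeal :=
    Localization.subalgebra.isLocalization_ofField K _ P.asIdeal.primeCompl_le_nonZeroDivisors
  have : IsFractionRing S K :=
    Localization.subalgebra.isFractionRing_ofField K _ P.asIdeal.primeCompl_le_nonZeroDivisors
  have := IsLocalization.AtPrime.isDiscreteValuationRing_of_dedekind_domain A P.ne_bot S
  have hunit (c : A) (hc : c ∉ P.asIdeal) : v (algebraMap A K c) = 1 :=
    (hle c).antisymm (not_lt.1 ((hlt c).not.2 hc))
  have hS (s : S) : ∃ a c : A, c ∉ P.asIdeal ∧ (s : K) * algebraMap A K c = algebraMap A K a := by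
    obtain ⟨⟨a, c⟩, h⟩ := IsLocalization.surj P.asIdeal.primeCompl s
    exact ⟨a, c, c.2, congrArg Subtype.val h⟩
  -- One of `x`, `x⁻¹` lies in the discrete valuation ring at `P`; in the second case `v x ≤ 1`
  -- forces the numerator of `x⁻¹` outside `P`.
  obtain ⟨a, c, hc, hac⟩ : ∃ a c : A, c ∉ P.asIdeal ∧ x * algebraMap A K c = algebraMap A K a := by
    rcases ValuationRing.isInteger_or_isInteger S x with ⟨s, hs⟩ | ⟨s, hs⟩
    · obtain ⟨a, c, hc, h⟩ := hS s
      exact ⟨a, c, hc, by rw [← hs]; exact h⟩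
    · obtain ⟨a, c, hc, h⟩ := hS s
      have hs' : (s : K) = x⁻¹ := hs
      rcases eq_or_ne x 0 with rfl | hx0
      · exact ⟨0, 1, P.asIdeal.ne_top_iff_one.1 P.isPrime.ne_top, by simp⟩
      refine ⟨c, a, fun ha => ?_, ?_⟩
      · have h1 := (hlt a).2 ha
        rw [← h, hs', map_mul, hunit c hc, mul_one, map_inv₀] at h1
        exact absurd hx (not_le.2 ((inv_lt_one₀ ((Valuation.pos_iff v).2 hx0)).1 h1))
      · rw [← h, hs', mul_inv_cancel_left₀ hx0]
  -- With `d` inverse to `c` modulo `P`, the difference `x - a * d = x * (1 - c * d)` has value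
  -- below `1`.
  obtain ⟨d, hd⟩ : ∃ d, 1 - c * d ∈ P.asIdeal := by
    let := Ideal.Quotient.field P.asIdeal
    obtain ⟨d, hd⟩ := Ideal.Quotient.mk_surjective (Ideal.Quotient.mk P.asIdeal c)⁻¹
    refine ⟨d, ?_⟩
    rw [← Ideal.Quotient.eq_zero_iff_mem, map_sub, map_mul, hd, map_one, mul_inv_cancel₀, sub_self]
    rwa [Ne, Ideal.Quotient.eq_zero_iff_mem]
  refine ⟨a * d, ?_⟩
  have : x - algebraMap A K (a * d) = x * algebraMap A K (1 - c * d) := by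
    rw [map_mul, ← hac, map_sub, map_mul, map_one]
    ring
  rw [this, map_mul]
  exact (mul_le_of_le_one_left' hx).trans_lt ((hlt _).2 hd)

/-- A valuation centred at a maximal ideal `P` has an `n`-divisible residue field if and only if
`A ⧸ P` is closed under `n`-th roots. -/
theorem IsDedekindDomain.HeightOneSpectrum.residueDivisible_iff (P : HeightOneSpectrum A)
    {v : Valuation K ℤᵐ⁰}
    (hle : ∀ a, v (algebraMap A K a) ≤ 1)
    (hlt : ∀ a, v (algebraMap A K a) < 1 ↔ a ∈ P.asIdeal) {n : ℕ} (hn : n ≠ 0) :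
    v.ResidueDivisible n ↔ RootClosed n (A ⧸ P.asIdeal) := by
  have hunit (c : A) (hc : c ∉ P.asIdeal) : v (algebraMap A K c) = 1 :=
    (hle c).antisymm (not_lt.1 ((hlt c).not.2 hc))
  constructor
  · intro h a
    obtain ⟨a, rfl⟩ := Ideal.Quotient.mk_surjective a
    by_cases ha : a ∈ P.asIdeal
    · exact ⟨0, by rw [zero_pow hn, Ideal.Quotient.eq_zero_iff_mem.2 ha]⟩
    obtain ⟨y, hy⟩ := h _ (hunit a ha)
    have hyn : v (y ^ n) ≤ 1 := by
      have := Valuation.map_sub_le v (hle a) hy.le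
      rwa [sub_sub_cancel] at this
    have hy1 : v y ≤ 1 := by
      rw [map_pow] at hyn
      exact (pow_le_one_iff hn).1 hyn
    obtain ⟨b, hb⟩ := P.exists_valuation_sub_lt_one hle hlt hy1
    have hbn : v (y ^ n - algebraMap A K b ^ n) < 1 := by
      obtain ⟨z, hz⟩ := sub_dvd_pow_sub_pow (⟨y, hy1⟩ : v.valuationSubring)
        ⟨algebraMap A K b, hle b⟩ n
      have hz' : y ^ n - algebraMap A K b ^ n = (y - algebraMap A K b) * z :=
        congrArg Subtype.val hz
      rw [hz', map_mul]
      exact mul_lt_one_of_lt_of_le hb z.2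
    refine ⟨Ideal.Quotient.mk _ b, ?_⟩
    rw [← map_pow, eq_comm, Ideal.Quotient.eq, ← hlt, map_sub, map_pow]
    have := Valuation.map_add_lt v hy hbn
    rwa [sub_add_sub_cancel] at this
  · intro h x hx
    obtain ⟨a, ha⟩ := P.exists_valuation_sub_lt_one hle hlt hx.le
    obtain ⟨b, hb⟩ := h (Ideal.Quotient.mk _ a)
    obtain ⟨b, rfl⟩ := Ideal.Quotient.mk_surjective b
    refine ⟨algebraMap A K b, ?_⟩
    rw [← map_pow, eq_comm, Ideal.Quotient.eq, ← hlt, map_sub, map_pow] at hb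
    have := Valuation.map_add_lt v ha hb
    rwa [sub_add_sub_cancel] at this

end DedekindAlgebra

/-- An affine chart of a curve `f : C ⟶ Spec k`: a Dedekind domain `A`, not a field, with fraction
field `k(C)`, together with an open immersion `Spec A ⟶ C` over `k`. -/
structure CurveChart {k : Type u} [Field k] {C : Scheme.{u}} [IsIntegral C]
    (f : C ⟶ Spec (.of k)) where
  A : Type u
  [commRing : CommRing A]
  [isDedekindDomain : IsDedekindDomain A]
  [algebra : Algebra k A]
  [finiteType : Algebra.FiniteType k A]
  [algebraFunctionField : Algebra A C.functionField]
  [isFractionRing : IsFractionRing A C.functionField]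
  not_isField : ¬ IsField A
  ι : Spec (.of A) ⟶ C
  [isOpenImmersion : IsOpenImmersion ι]
  ι_comp : ι ≫ f = Spec.map (CommRingCat.ofHom (algebraMap k A))
  algebraMap_algebraMap (c : k) :
    algebraMap A C.functionField (algebraMap k A c) = constantsHom f c
  map_comp_ι : Spec.map (CommRingCat.ofHom (algebraMap A C.functionField)) ≫ ι =
    C.fromSpecStalk (genericPoint C)

attribute [instance] CurveChart.commRing CurveChart.isDedekindDomain CurveChart.algebra
  CurveChart.finiteType CurveChart.algebraFunctionField CurveChart.isFractionRing
  CurveChart.isOpenImmersion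

/-! ### Affine charts of a regular projective curve. -/

section Charts

variable {k : Type u} [Field k] {C : Scheme.{u}} {f : C ⟶ Spec (.of k)}

theorem exists_isAffineOpen_mem {X : Scheme.{u}} (x : X) :
    ∃ U : X.Opens, IsAffineOpen U ∧ x ∈ U := by
  obtain ⟨_, ⟨U, hU, rfl⟩, hxU, -⟩ :=
    X.isBasis_affineOpens.exists_subset_of_mem_open (Set.mem_univ x) isOpen_univ
  exact ⟨U, hU, hxU⟩

/-- The `k`-algebra structure on the sections of a `k`-scheme. -/
def sectionsHom (f : C ⟶ Spec (.of k)) (U : C.Opens) : k →+* Γ(C, U) :=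
  ((Scheme.ΓSpecIso (.of k)).inv ≫ f.appLE ⊤ U le_top).hom

theorem fromSpec_comp_eq_map_sectionsHom {U : C.Opens} (hU : IsAffineOpen U) :
    hU.fromSpec ≫ f = Spec.map (CommRingCat.ofHom (sectionsHom f U)) := by
  rw [← IsAffineOpen.SpecMap_appLE_fromSpec f (isAffineOpen_top (Spec (.of k))) hU le_top,
    IsAffineOpen.fromSpec_top, Scheme.isoSpec_Spec_inv, ← Spec.map_comp]
  rfl

theorem germToFunctionField_sectionsHom [IsIntegral C] (U : C.Opens) [Nonempty U] (c : k) :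
    C.germToFunctionField U (sectionsHom f U c) = constantsHom f c := by
  have : Nonempty (⊤ : C.Opens) := ⟨⟨genericPoint C, trivial⟩⟩
  have : f.appLE ⊤ U le_top ≫ C.germToFunctionField U = f.appTop ≫ C.germToFunctionField ⊤ := by
    have h1 : f.appTop ≫ C.presheaf.map (homOfLE (le_top : U ≤ ⊤)).op = f.appLE ⊤ U le_top := by
      rw [Scheme.Hom.appTop, Scheme.Hom.app_eq_appLE]
      exact Scheme.Hom.appLE_map ..
    rw [← h1, Category.assoc]
    exact congrArg (f.appTop ≫ ·) (C.presheaf.germ_res (homOfLE (le_top : U ≤ ⊤)) _ _)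
  have h2 := congrArg (fun g => ((Scheme.ΓSpecIso (.of k)).inv ≫ g).hom c) this
  exact h2

theorem finiteType_sectionsHom [LocallyOfFiniteType f] {U : C.Opens} (hU : IsAffineOpen U) :
    (sectionsHom f U).FiniteType := by
  have h := f.finiteType_appLE (isAffineOpen_top (Spec (.of k))) hU le_top
  refine RingHom.FiniteType.comp h (RingHom.FiniteType.of_surjective _ ?_)
  exact (Scheme.ΓSpecIso (.of k)).symm.commRingCatIsoToRingEquiv.surjective

theorem ringKrullDim_le_topologicalKrullDim {U : C.Opens} (hU : IsAffineOpen U) :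
    ringKrullDim Γ(C, U) ≤ topologicalKrullDim C := by
  rw [← PrimeSpectrum.topologicalKrullDim_eq_ringKrullDim]
  exact hU.fromSpec.isOpenEmbedding.isInducing.topologicalKrullDim_le

theorem isRegularLocalRing_localization {U : C.Opens} (hU : IsAffineOpen U)
    (h : ∀ x : C, IsRegularLocalRing (C.presheaf.stalk x)) (P : Ideal Γ(C, U)) [P.IsPrime] :
    IsRegularLocalRing (Localization.AtPrime P) := by
  let y : PrimeSpectrum Γ(C, U) := ⟨P, inferInstance⟩
  have hy : hU.fromSpec y ∈ U := by
    have : hU.fromSpec y ∈ Set.range hU.fromSpec := Set.mem_range_self y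
    rwa [hU.range_fromSpec] at this
  let := TopCat.Presheaf.algebra_section_stalk C.presheaf (⟨hU.fromSpec y, hy⟩ : U)
  have : IsLocalization P.primeCompl (C.presheaf.stalk (hU.fromSpec y)) :=
    hU.isLocalization_stalk' y hy
  have := h (hU.fromSpec y)
  exact IsRegularLocalRing.of_ringEquiv
    (IsLocalization.algEquiv P.primeCompl (C.presheaf.stalk (hU.fromSpec y))
      (Localization.AtPrime P)).toRingEquiv

theorem IsRegularProjectiveCurve.isDedekindDomain_sections (hC : IsRegularProjectiveCurve f)
    {U : C.Opens} (hU : IsAffineOpen U) [Nonempty U] : IsDedekindDomain Γ(C, U) := by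
  have := hC.isIntegral
  have := hC.locallyOfFiniteType
  have : IsNoetherianRing Γ(C, U) := by
    let := (sectionsHom f U).toAlgebra
    have : Algebra.FiniteType k Γ(C, U) := finiteType_sectionsHom hU
    exact Algebra.FiniteType.isNoetherianRing k _
  exact isDedekindDomain_of_isRegularLocalRing
    ((ringKrullDim_le_topologicalKrullDim hU).trans hC.dim_eq_one.le)
    fun P _ => isRegularLocalRing_localization hU hC.isRegular P

/-- The function field of a curve is not algebraic over the constants. -/
theorem IsRegularProjectiveCurve.not_isIntegral (hC : IsRegularProjectiveCurve f) :
    haveI := hC.isIntegral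
    ¬ (constantsHom f).IsIntegral := by
  have := hC.isIntegral
  intro hint
  -- If the function field were integral over `k`, every nonempty affine open would have a field of
  -- sections, so each point would be generic and the dimension would be `0`.
  have hsub : Subsingleton C := by
    refine ⟨fun x y => ?_⟩
    suffices h : ∀ x : C, x = genericPoint C by rw [h x, h y]
    intro x
    obtain ⟨U, hU, hxU⟩ := exists_isAffineOpen_mem x
    have hgU : genericPoint C ∈ U :=
      ((genericPoint_spec C).mem_open_set_iff U.isOpen).2 ⟨x, trivial, hxU⟩
    have : Nonempty U := ⟨⟨x, hxU⟩⟩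
    have hF : IsField Γ(C, U) := by
      let := (sectionsHom f U).toAlgebra
      have : Algebra.IsIntegral k Γ(C, U) := ⟨fun a => by
        obtain ⟨p, hp, hpa⟩ := hint (C.germToFunctionField U a)
        refine ⟨p, hp, C.germToFunctionField_injective U ?_⟩
        rw [map_zero, ← hpa]
        have h := hom_eval₂ p (algebraMap k Γ(C, U)) (C.germToFunctionField U).hom a
        refine h.trans ?_
        congr 1
        ext c
        exact germToFunctionField_sectionsHom U c⟩
      exact isField_of_isIntegral_of_isField' (Field.toIsField k)
    have hs : Subsingleton (PrimeSpectrum Γ(C, U)) := by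
      let := hF.toField
      infer_instance
    obtain ⟨p, hp⟩ : x ∈ Set.range hU.fromSpec := by rwa [hU.range_fromSpec]
    obtain ⟨q, hq⟩ : genericPoint C ∈ Set.range hU.fromSpec := by rwa [hU.range_fromSpec]
    rw [← hp, ← hq, hs.elim p q]
  have : DiscreteTopology C := inferInstance
  have h0 := topologicalKrullDim_zero_of_discreteTopology C
  rw [hC.dim_eq_one] at h0
  exact absurd h0 (by decide)

/-- Sections forming a field are finite over `k` by Zariski's lemma and equal to the function field,
which would then be integral over `k`. -/
theorem IsRegularProjectiveCurve.not_isField_sections (hC : IsRegularProjectiveCurve f)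
    {U : C.Opens} (hU : IsAffineOpen U) [Nonempty U] : ¬ IsField Γ(C, U) := by
  have := hC.isIntegral
  have := hC.locallyOfFiniteType
  intro hF
  refine hC.not_isIntegral fun x => ?_
  let := hF.toField
  let := (sectionsHom f U).toAlgebra
  have : Algebra.FiniteType k Γ(C, U) := finiteType_sectionsHom hU
  have : Module.Finite k Γ(C, U) := finite_of_finite_type_of_isJacobsonRing k _
  have := functionField_isFractionRing_of_isAffineOpen C U hU
  obtain ⟨a, rfl⟩ : ∃ a, algebraMap Γ(C, U) C.functionField a = x :=
    IsFractionRing.surjective_iff_isField.2 hF x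
  obtain ⟨p, hp, hpa⟩ := Algebra.IsIntegral.isIntegral (R := k) a
  refine ⟨p, hp, ?_⟩
  have h := hom_eval₂ p (algebraMap k Γ(C, U)) (C.germToFunctionField U).hom a
  rw [hpa, map_zero] at h
  refine Eq.trans ?_ h.symm
  congr 1
  ext c
  exact (germToFunctionField_sectionsHom U c).symm

/-- Every point of a regular projective curve lies in an affine chart. -/
theorem IsRegularProjectiveCurve.exists_curveChart (hC : IsRegularProjectiveCurve f) (x : C) :
    haveI := hC.isIntegral
    ∃ c : CurveChart f, x ∈ Set.range c.ι := by
  have := hC.isIntegral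
  have := hC.locallyOfFiniteType
  obtain ⟨U, hU, hxU⟩ := exists_isAffineOpen_mem x
  have : Nonempty U := ⟨⟨x, hxU⟩⟩
  have hgU : genericPoint C ∈ U :=
    ((genericPoint_spec C).mem_open_set_iff U.isOpen).2 ⟨x, trivial, hxU⟩
  let := (sectionsHom f U).toAlgebra
  have : Algebra.FiniteType k Γ(C, U) := finiteType_sectionsHom hU
  have := functionField_isFractionRing_of_isAffineOpen C U hU
  have := hC.isDedekindDomain_sections hU
  refine ⟨
    { A := Γ(C, U)
      not_isField := hC.not_isField_sections hU
      ι := hU.fromSpec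
      isOpenImmersion := inferInstance
      ι_comp := fromSpec_comp_eq_map_sectionsHom hU
      algebraMap_algebraMap := germToFunctionField_sectionsHom U
      map_comp_ι := hU.fromSpecStalk_eq_fromSpecStalk hgU }, ?_⟩
  change x ∈ Set.range hU.fromSpec
  rwa [hU.range_fromSpec]

end Charts

/-! ### Universal closedness of projective space. -/

section Projective

attribute [local instance] MvPolynomial.gradedAlgebra

variable (k : Type u) [Field k]

theorem algebraMap_homogeneousSubmodule_zero_bijective (n : ℕ) : Function.Bijective
    (algebraMap k (MvPolynomial.homogeneousSubmodule (Fin (n + 1)) k 0)) := by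
  refine ⟨fun a b h => MvPolynomial.C_injective (Fin (n + 1)) k (congrArg Subtype.val h),
    fun x => ?_⟩
  obtain ⟨c, hc⟩ : ∃ c, x.1 = MvPolynomial.C c :=
    ⟨_, MvPolynomial.totalDegree_eq_zero_iff_eq_C.1
      (Nat.le_zero.1 ((MvPolynomial.mem_homogeneousSubmodule 0 x.1).1 x.2).totalDegree_le)⟩
  exact ⟨c, Subtype.ext hc.symm⟩

theorem universallyClosed_projectiveSpaceStructure (n : ℕ) :
    UniversallyClosed (projectiveSpaceStructure k n) := by
  have : Algebra.FiniteType (MvPolynomial.homogeneousSubmodule (Fin (n + 1)) k 0)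
      (MvPolynomial (Fin (n + 1)) k) := by
    rw [← RingHom.finiteType_algebraMap]
    refine RingHom.FiniteType.of_comp_finiteType
      (f := algebraMap k (MvPolynomial.homogeneousSubmodule (Fin (n + 1)) k 0)) ?_
    exact RingHom.finiteType_algebraMap.2
      (inferInstance : Algebra.FiniteType k (MvPolynomial (Fin (n + 1)) k))
  have : IsIso (CommRingCat.ofHom
      (algebraMap k (MvPolynomial.homogeneousSubmodule (Fin (n + 1)) k 0))) :=
    (ConcreteCategory.isIso_iff_bijective _).2 (algebraMap_homogeneousSubmodule_zero_bijective k n)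
  rw [projectiveSpaceStructure]
  infer_instance

end Projective

/-! ### Centres of valuations via the valuative criterion. -/

section Center

variable {k : Type u} [Field k] {C : Scheme.{u}} {f : C ⟶ Spec (.of k)}

theorem IsRegularProjectiveCurve.universallyClosed (hC : IsRegularProjectiveCurve f) :
    UniversallyClosed f := by
  obtain ⟨n, i, hi, rfl⟩ := hC.isProjective
  have := universallyClosed_projectiveSpaceStructure k n
  infer_instance

theorem fromSpecStalk_genericPoint_comp [IsIntegral C] (c : CurveChart f) :
    C.fromSpecStalk (genericPoint C) ≫ f = Spec.map (CommRingCat.ofHom (constantsHom f)) := by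
  rw [← c.map_comp_ι, Category.assoc, c.ι_comp, ← Spec.map_comp, ← CommRingCat.ofHom_comp]
  congr 2
  ext x
  exact c.algebraMap_algebraMap x

/-- The valuative criterion: a valuation of the function field that is trivial on constants is
centred in some affine chart. -/
theorem IsRegularProjectiveCurve.exists_curveChart_forall_le_one (hC : IsRegularProjectiveCurve f) :
    haveI := hC.isIntegral
    ∀ v : Valuation C.functionField ℤᵐ⁰, (∀ x : k, x ≠ 0 → v (constantsHom f x) = 1) →
      ∃ c : CurveChart f, ∀ a : c.A, v (algebraMap c.A C.functionField a) ≤ 1 := by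
  have := hC.isIntegral
  intro v hv
  have := hC.universallyClosed
  obtain ⟨c₀, -⟩ := hC.exists_curveChart (genericPoint C)
  let φ : k →+* v.valuationSubring := (constantsHom f).codRestrict v.valuationSubring fun x => by
    rcases eq_or_ne x 0 with rfl | hx
    · simp
    · exact (hv x hx).le
  have hex : ValuativeCriterion.Existence f := by
    have h := (inferInstance : UniversallyClosed f)
    rw [UniversallyClosed.eq_valuativeCriterion] at h
    exact h.1
  -- The generic point extends to the spectrum of the valuation ring. A chart containing the image
  -- of the closed point contains the whole image, so its ring maps into the valuation ring.
  obtain ⟨l, hl, -⟩ := (hex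
    { R := v.valuationSubring
      K := C.functionField
      i₁ := C.fromSpecStalk (genericPoint C)
      i₂ := Spec.map (CommRingCat.ofHom φ)
      commSq := ⟨by
        rw [fromSpecStalk_genericPoint_comp c₀, ← Spec.map_comp]
        rfl⟩ }).exists_lift
  dsimp only at l hl
  obtain ⟨c, hc⟩ := hC.exists_curveChart (l (IsLocalRing.closedPoint v.valuationSubring))
  have hrange : Set.range l ⊆ Set.range c.ι := by
    have := Scheme.preimage_eq_top_of_closedPoint_mem l (U := c.ι.opensRange) hc
    rintro _ ⟨y, rfl⟩
    have hy : y ∈ l ⁻¹ᵁ c.ι.opensRange := this ▸ trivial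
    exact hy
  obtain ⟨ψ, hψ⟩ := Spec.map_surjective (IsOpenImmersion.lift c.ι l hrange)
  have hψl : Spec.map ψ ≫ c.ι = l := by rw [hψ, IsOpenImmersion.lift_fac]
  have hcomp : ψ ≫ CommRingCat.ofHom (algebraMap v.valuationSubring C.functionField) =
      CommRingCat.ofHom (algebraMap c.A C.functionField) := by
    apply Spec.map_injective
    rw [← cancel_mono c.ι, c.map_comp_ι, Spec.map_comp, Category.assoc, hψl, hl]
  refine ⟨c, fun a => ?_⟩
  have h := congrArg (fun g => g.hom a) hcomp
  have h2 : algebraMap c.A C.functionField a = (ψ.hom a : v.valuationSubring).1 := h.symm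
  rw [h2]
  exact (ψ.hom a).2

end Center

/-! ### Places, closed points and field-valued points of charts. -/

section Places

open IsDedekindDomain

variable {k : Type u} [Field k] {C : Scheme.{u}} {f : C ⟶ Spec (.of k)}

/-- The centre of a valuation that is nonnegative on a Dedekind domain. -/
theorem exists_heightOneSpectrum_of_valuation_le_one {A K : Type*} [CommRing A]
    [IsDedekindDomain A] [Field K] [Algebra A K] [IsFractionRing A K] {v : Valuation K ℤᵐ⁰}
    (hv : Function.Surjective v) (hle : ∀ a, v (algebraMap A K a) ≤ 1) :
    ∃ P : HeightOneSpectrum A, ∀ a, v (algebraMap A K a) < 1 ↔ a ∈ P.asIdeal := by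
  let P : Ideal A :=
    { carrier := {a | v (algebraMap A K a) < 1}
      add_mem' := fun ha hb => by
        rw [Set.mem_ofPred_eq, map_add]
        exact v.map_add_lt ha hb
      zero_mem' := by simp
      smul_mem' := fun c a ha => by
        rw [Set.mem_ofPred_eq, smul_eq_mul, map_mul, map_mul]
        exact (mul_le_of_le_one_left' (hle c)).trans_lt ha }
  have hmem (a : A) : a ∈ P ↔ v (algebraMap A K a) < 1 := Iff.rfl
  have hP : P.IsPrime := by
    refine ⟨(Ideal.ne_top_iff_one _).2 fun h => ?_, fun {a b} hab => ?_⟩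
    · simp [hmem] at h
    · by_contra! h
      rw [hmem, hmem, not_lt, not_lt] at h
      rw [hmem, map_mul, map_mul, (hle a).antisymm h.1, (hle b).antisymm h.2, one_mul] at hab
      exact lt_irrefl _ hab
  -- With zero centre, `v` would be trivial on the fraction field, against surjectivity.
  refine ⟨⟨P, hP, fun h => ?_⟩, fun a => Iff.rfl⟩
  obtain ⟨x, hx⟩ := hv (WithZero.exp (-1 : ℤ))
  obtain ⟨a, b, hb, rfl⟩ := IsFractionRing.div_surjective (A := A) x
  have hone (a : A) (ha : a ≠ 0) : v (algebraMap A K a) = 1 := by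
    refine (hle a).antisymm (not_lt.1 fun hlt => ha ?_)
    rwa [← hmem, h, Ideal.mem_bot] at hlt
  have ha : a ≠ 0 := by
    rintro rfl
    rw [map_zero, zero_div, map_zero] at hx
    exact WithZero.exp_ne_zero hx.symm
  rw [map_div₀, hone a ha, hone b (nonZeroDivisors.ne_zero hb), div_one, ← WithZero.exp_zero,
    WithZero.exp_inj] at hx
  norm_num at hx

namespace CurveChart

variable [IsIntegral C] (c : CurveChart f)

theorem valuation_constantsHom (P : HeightOneSpectrum c.A) (x : k) (hx : x ≠ 0) :
    P.valuation C.functionField (constantsHom f x) = 1 := by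
  rw [← c.algebraMap_algebraMap]
  refine (HeightOneSpectrum.valuation_eq_one_iff_notMem _).2 fun h => ?_
  exact P.isPrime.ne_top (Ideal.eq_top_of_isUnit_mem _ h ((IsUnit.mk0 x hx).map _))

theorem nonempty_pointsOver {R : Type u} [Field R] [Algebra k R] (g : c.A →ₐ[k] R) :
    Nonempty (PointsOver f R) := by
  refine ⟨⟨Spec.map (CommRingCat.ofHom g.toRingHom) ≫ c.ι, ?_⟩⟩
  rw [Category.assoc, c.ι_comp, ← Spec.map_comp, ← CommRingCat.ofHom_comp]
  congr 2
  exact g.comp_algebraMap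

end CurveChart

theorem IsRegularProjectiveCurve.exists_algHom_of_pointsOver (hC : IsRegularProjectiveCurve f)
    {R : Type u} [Field R] [Algebra k R] (p : PointsOver f R) :
    haveI := hC.isIntegral
    ∃ c : CurveChart f, Nonempty (c.A →ₐ[k] R) := by
  have := hC.isIntegral
  obtain ⟨g, hg⟩ := p
  obtain ⟨c, hc⟩ := hC.exists_curveChart (g (IsLocalRing.closedPoint R))
  have hrange : Set.range g ⊆ Set.range c.ι := by
    have := Scheme.preimage_eq_top_of_closedPoint_mem g (U := c.ι.opensRange) hc
    rintro _ ⟨y, rfl⟩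
    have hy : y ∈ g ⁻¹ᵁ c.ι.opensRange := this ▸ trivial
    exact hy
  obtain ⟨ψ, hψ⟩ := Spec.map_surjective (IsOpenImmersion.lift c.ι g hrange)
  have hψl : Spec.map ψ ≫ c.ι = g := by rw [hψ, IsOpenImmersion.lift_fac]
  have hcomp : CommRingCat.ofHom (algebraMap k c.A) ≫ ψ = CommRingCat.ofHom (algebraMap k R) := by
    apply Spec.map_injective
    rw [Spec.map_comp, ← c.ι_comp, ← Category.assoc, hψl, hg]
  exact ⟨c, ⟨{ ψ.hom with
    commutes' := fun x => congrArg (fun h => h.hom x) hcomp }⟩⟩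

/-- The kernel of a homomorphism from a one-dimensional algebra to an algebraic extension is a
nonzero prime. -/
theorem exists_heightOneSpectrum_of_algHom {k A R : Type*} [Field k] [CommRing A]
    [IsDedekindDomain A] [Algebra k A] [Field R] [Algebra k R] [Algebra.IsAlgebraic k R]
    (hA : ¬ IsField A) (g : A →ₐ[k] R) :
    ∃ P : HeightOneSpectrum A, P.asIdeal = RingHom.ker g := by
  refine ⟨⟨RingHom.ker g, RingHom.ker_isPrime _, fun h => hA ?_⟩, rfl⟩
  have hinj : Function.Injective g := (RingHom.injective_iff_ker_eq_bot _).2 h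
  have : Algebra.IsIntegral k A := ⟨fun a =>
    (isIntegral_algHom_iff g hinj).1 (Algebra.IsIntegral.isIntegral (g a))⟩
  exact isField_of_isIntegral_of_isField' (Field.toIsField k)

end Places

/-! ### Number fields. -/

section NumberField

open IsDedekindDomain NumberField

/-- Since `p ∣ ℓ - 1`, the prime field has a nontrivial `p`-th root of unity, so the `p`-th power
map of the finite field `F` is not injective and hence not surjective. -/
theorem not_rootClosed_of_modEq_one {F : Type*} [Field F] [Finite F] {p ℓ : ℕ} (hp : p.Prime)
    [Fact ℓ.Prime] [CharP F ℓ] (h : ℓ ≡ 1 [MOD p]) : ¬ RootClosed p F := by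
  intro hF
  have : Fact p.Prime := ⟨hp⟩
  have hdvd : p ∣ Nat.card (ZMod ℓ)ˣ := by
    rw [Nat.card_eq_fintype_card, ZMod.card_units]
    exact (Nat.modEq_iff_dvd' (Fact.out : ℓ.Prime).one_le).1 h.symm
  obtain ⟨x, hx⟩ := exists_prime_orderOf_dvd_card' p hdvd
  have hsurj : Function.Surjective fun y : F => y ^ p := hF
  have hinj := Finite.injective_iff_surjective.2 hsurj
  let φ : ZMod ℓ →+* F := ZMod.castHom dvd_rfl F
  have h1 : φ (x : ZMod ℓ) = 1 := hinj (by
    change φ x ^ p = 1 ^ p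
    rw [← map_pow, ← Units.val_pow_eq_pow_val, ← hx, pow_orderOf_eq_one, Units.val_one, map_one,
      one_pow])
  have h2 : x = 1 := Units.ext (φ.injective (by rw [h1, Units.val_one, map_one]))
  rw [h2, orderOf_one] at hx
  exact hp.one_lt.ne hx

variable (K : Type u) [Field K] [NumberField K]

theorem exists_heightOneSpectrum_natCast_mem {ℓ : ℕ} (hℓ : ℓ.Prime) :
    ∃ P : HeightOneSpectrum (𝓞 K), (ℓ : 𝓞 K) ∈ P.asIdeal := by
  have hirr : Irreducible (ℓ : ℤ) := (Nat.prime_iff_prime_int.1 hℓ).irreducible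
  have : (Ideal.span {(ℓ : ℤ)}).IsMaximal := PrincipalIdealRing.isMaximal_of_irreducible hirr
  obtain ⟨P, hP, hPℓ⟩ := Ideal.exists_ideal_over_maximal_of_isIntegral (S := 𝓞 K)
    (Ideal.span {(ℓ : ℤ)}) (by
      rw [(RingHom.injective_iff_ker_eq_bot (algebraMap ℤ (𝓞 K))).1
        (FaithfulSMul.algebraMap_injective ℤ (𝓞 K))]
      exact bot_le)
  have hmem : (ℓ : 𝓞 K) ∈ P := by
    have : (ℓ : ℤ) ∈ P.comap (algebraMap ℤ (𝓞 K)) := hPℓ ▸ Ideal.mem_span_singleton_self _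
    simpa using this
  refine ⟨⟨P, hP.isPrime, fun h => ?_⟩, hmem⟩
  rw [h, Ideal.mem_bot] at hmem
  exact hℓ.ne_zero (by exact_mod_cast hmem)

/-- The place of a number field attached to a maximal ideal of its ring of integers. -/
def numberFieldPlace (P : HeightOneSpectrum (𝓞 K)) : (PFField.numberField K).FinitePlace :=
  ⟨P.valuation K, P.valuation_surjective K, trivial⟩

variable {K} in
theorem not_isNDivisible_numberFieldPlace {P : HeightOneSpectrum (𝓞 K)} {p ℓ : ℕ} (hp : p.Prime)
    (hℓ : ℓ.Prime) (h : ℓ ≡ 1 [MOD p]) (hP : (ℓ : 𝓞 K) ∈ P.asIdeal) :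
    ¬ IsNDivisible p ((PFField.numberField K).LocalRing (.inl (numberFieldPlace K P)))ˣ := by
  intro hdiv
  have hres : (P.valuation K).ResidueDivisible p :=
    Valuation.residueDivisible_of_isNDivisible hdiv
  rw [P.residueDivisible_iff P.valuation_le_one P.valuation_lt_one_iff_mem hp.ne_zero] at hres
  let := Ideal.Quotient.field P.asIdeal
  have : Finite (𝓞 K ⧸ P.asIdeal) := Ideal.finiteQuotientOfFreeOfNeBot _ P.ne_bot
  have : Fact ℓ.Prime := ⟨hℓ⟩
  have : CharP (𝓞 K ⧸ P.asIdeal) ℓ := (CharP.charP_iff_prime_eq_zero hℓ).2 (by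
    rw [← map_natCast (Ideal.Quotient.mk P.asIdeal), Ideal.Quotient.eq_zero_iff_mem]
    exact hP)
  exact not_rootClosed_of_modEq_one hp h hres

/-- For a prime `p ∣ n`, each of the infinitely many primes `ℓ ≡ 1` modulo `p` gives a bad place.
Distinct `ℓ` give distinct places, since coprime integers share no maximal ideal. -/
theorem infinite_setOf_not_isNDivisible_numberField {n : ℕ} (hn : n ≠ 1) :
    {v : (PFField.numberField K).Place |
      ¬ IsNDivisible n ((PFField.numberField K).LocalRing v)ˣ}.Infinite := by
  obtain ⟨p, hp, m, rfl⟩ := Nat.exists_prime_and_dvd hn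
  have hS : {ℓ : ℕ | ℓ.Prime ∧ ℓ ≡ 1 [MOD p]}.Infinite :=
    Nat.infinite_setOfPred_prime_modEq_one hp.ne_zero
  have : Nonempty (HeightOneSpectrum (𝓞 K)) :=
    ⟨(exists_heightOneSpectrum_natCast_mem K Nat.prime_two).choose⟩
  choose! P hP using fun ℓ (hℓ : ℓ ∈ {ℓ : ℕ | ℓ.Prime ∧ ℓ ≡ 1 [MOD p]}) =>
    exists_heightOneSpectrum_natCast_mem K hℓ.1
  refine Set.infinite_of_injOn_mapsTo (f := fun ℓ => .inl (numberFieldPlace K (P ℓ)))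
    (fun ℓ hℓ ℓ' hℓ' heq => ?_) (fun ℓ hℓ hdiv => ?_) hS
  · have hPP : P ℓ = P ℓ' := HeightOneSpectrum.eq_of_valuation_isEquiv_valuation (K := K) (by
      rw [show (P ℓ).valuation K = (P ℓ').valuation K from
        congrArg Subtype.val (Sum.inl_injective heq)])
    by_contra hne
    refine (P ℓ).isPrime.ne_top ((Ideal.eq_top_iff_one _).2 ?_)
    have hco := Nat.isCoprime_iff_coprime.2 ((Nat.coprime_primes hℓ.1 hℓ'.1).2 hne)
    obtain ⟨a, b, hab⟩ := hco
    have h1 : (a : 𝓞 K) * ℓ + b * ℓ' = 1 := by exact_mod_cast congrArg (Int.cast : ℤ → 𝓞 K) hab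
    rw [← h1]
    exact add_mem (Ideal.mul_mem_left _ _ (hP ℓ hℓ)) (Ideal.mul_mem_left _ _ (hPP ▸ hP ℓ' hℓ'))
  · rw [mul_comm] at hdiv
    exact not_isNDivisible_numberFieldPlace hp hℓ.1 hℓ.2 (hP ℓ hℓ) hdiv.of_mul_left

theorem rho_numberField : (PFField.numberField K).rho = {1} := by
  ext n
  rw [Set.mem_singleton_iff]
  constructor
  · rintro ⟨-, h⟩
    by_contra hn
    obtain ⟨v, hv⟩ := (infinite_setOf_not_isNDivisible_numberField K hn).nonempty
    exact hv (h v)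
  · rintro rfl
    exact ⟨one_pos, fun v => isNDivisible_one⟩

end NumberField

/-! ### Function fields. -/

section FunctionField

open IsDedekindDomain

variable {k : Type u} [Field k] {C : Scheme.{u}} {f : C ⟶ Spec (.of k)}
  (hC : IsRegularProjectiveCurve f)

theorem natCast_ne_zero_iff_ne_ringChar {k : Type*} [Field k] {p : ℕ} (hp : p.Prime) :
    (p : k) ≠ 0 ↔ p ≠ ringChar k := by
  rw [Ne, ringChar.spec, not_iff_not]
  refine ⟨fun h => ?_, fun h => h ▸ dvd_rfl⟩
  exact (((Nat.dvd_prime hp).1 h).resolve_left (CharP.ringChar_ne_one)).symm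

variable {hC} in
theorem FinitePlace.valuation_natCast (v : (PFField.functionField k C f hC).FinitePlace) {p : ℕ}
    (hp : (p : k) ≠ 0) :
    v.1 p = 1 := by
  have := hC.isIntegral
  have h := v.2.2 p hp
  have h2 : constantsHom f (p : k) = ((p : C.functionField)) := map_natCast _ p
  rw [h2] at h
  exact h

/-- The place is centred at a closed point of a chart, and since `p` is a unit the residue field
there decides divisibility. -/
theorem exists_curveChart_isNDivisible_iff (v : (PFField.functionField k C f hC).FinitePlace)
    {p : ℕ} (hp : (p : k) ≠ 0) :
    haveI := hC.isIntegral
    ∃ (c : CurveChart f) (P : HeightOneSpectrum c.A),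
      IsNDivisible p ((PFField.functionField k C f hC).LocalRing (.inl v))ˣ ↔
        RootClosed p (c.A ⧸ P.asIdeal) := by
  have := hC.isIntegral
  obtain ⟨c, hc⟩ := hC.exists_curveChart_forall_le_one v.1 v.2.2
  obtain ⟨P, hP⟩ := exists_heightOneSpectrum_of_valuation_le_one (A := c.A) (K := C.functionField)
    v.2.1 hc
  have hp0 : p ≠ 0 := by
    rintro rfl
    simp at hp
  refine ⟨c, P, ?_⟩
  rw [← P.residueDivisible_iff (K := C.functionField) hc hP hp0]
  exact ⟨fun h => Valuation.residueDivisible_of_isNDivisible (v := v.1) h,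
    fun h => Valuation.isNDivisible_of_residueDivisible (v := v.1) v.2.1
      (FinitePlace.valuation_natCast v hp) h⟩

/-- The place attached to a closed point of an affine chart. -/
def CurveChart.place [IsIntegral C] (c : CurveChart f) (P : HeightOneSpectrum c.A) :
    (PFField.functionField k C f hC).FinitePlace :=
  ⟨P.valuation C.functionField, P.valuation_surjective C.functionField,
    c.valuation_constantsHom P⟩

theorem CurveChart.place_injective [IsIntegral C] (c : CurveChart f) :
    Function.Injective (c.place hC) := fun P Q h =>
  HeightOneSpectrum.eq_of_valuation_isEquiv_valuation (K := C.functionField) (by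
    rw [show P.valuation C.functionField = Q.valuation C.functionField from congrArg Subtype.val h])

theorem CurveChart.rootClosed_of_isNDivisible [IsIntegral C] (c : CurveChart f)
    {P : HeightOneSpectrum c.A} {p : ℕ} (hp : p ≠ 0)
    (h : IsNDivisible p ((PFField.functionField k C f hC).LocalRing (.inl (c.place hC P)))ˣ) :
    RootClosed p (c.A ⧸ P.asIdeal) := by
  rw [← P.residueDivisible_iff (K := C.functionField) P.valuation_le_one
    P.valuation_lt_one_iff_mem hp]
  exact Valuation.residueDivisible_of_isNDivisible h

theorem CurveChart.infinite_setOf_not_isNDivisible [IsIntegral C] (c : CurveChart f) {p : ℕ}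
    (hp : p ≠ 0)
    (h : {P : HeightOneSpectrum c.A | ¬ RootClosed p (c.A ⧸ P.asIdeal)}.Infinite) :
    {v : (PFField.functionField k C f hC).Place |
      ¬ IsNDivisible p ((PFField.functionField k C f hC).LocalRing v)ˣ}.Infinite := by
  refine Set.infinite_of_injOn_mapsTo (f := fun P => .inl (c.place hC P))
    (fun _ _ _ _ heq => c.place_injective hC (Sum.inl_injective heq)) (fun P hP hdiv => ?_) h
  exact hP (c.rootClosed_of_isNDivisible hC hp hdiv)

theorem CurveChart.infinite_heightOneSpectrum [IsIntegral C] (c : CurveChart f) :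
    Infinite (HeightOneSpectrum c.A) :=
  Set.infinite_univ_iff.1 ((infinite_setOf_nonempty_algHom (k := k) c.not_isField k).mono
    (Set.subset_univ _))

theorem prime_mem_rho_iff {p : ℕ} (hp : p.Prime) :
    p ∈ (PFField.functionField k C f hC).rho ↔ ∀ v : (PFField.functionField k C f hC).FinitePlace,
      IsNDivisible p ((PFField.functionField k C f hC).LocalRing (.inl v))ˣ :=
  ⟨fun h v => h.2 (.inl v), fun h => ⟨hp.pos, fun v => match v with
    | .inl w => h w
    | .inr w => PEmpty.elim w⟩⟩

theorem CurveChart.infinite_setOf_not_isNDivisible_of_eq_ringChar [IsIntegral C] (c : CurveChart f)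
    {p : ℕ} (hp : p.Prime)
    (hpk : p = ringChar k) :
    {v : (PFField.functionField k C f hC).Place |
      ¬ IsNDivisible p ((PFField.functionField k C f hC).LocalRing v)ˣ}.Infinite := by
  have := c.infinite_heightOneSpectrum
  have hk : CharP k p := hpk ▸ ringChar.charP k
  have hK : CharP C.functionField p := charP_of_injective_ringHom (constantsHom f).injective p
  refine Set.infinite_of_injective_forall_mem (f := fun P => .inl (c.place hC P))
    (fun _ _ heq => c.place_injective hC (Sum.inl_injective heq)) fun P => ?_
  exact Valuation.not_isNDivisible_of_charP (v := P.valuation C.functionField)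
    (P.valuation_surjective C.functionField) hp

/-- Allowing finitely many bad places lets this dichotomy serve both the description of `ρ` and the
infinitude of bad places. If `√-1 ∈ k`, the second alternative collapses into `2`-closedness. -/
theorem CurveChart.isNClosed_or_quadraticallyClosedOverI [IsIntegral C] (c : CurveChart f) {p : ℕ}
    (hp : p.Prime) (hpk : (p : k) ≠ 0)
    (h : {v : (PFField.functionField k C f hC).Place |
      ¬ IsNDivisible p ((PFField.functionField k C f hC).LocalRing v)ˣ}.Finite) :
    IsNClosed p k ∨ p = 2 ∧ QuadraticallyClosedOverI k ∧ ¬ IsSquare (-1 : k) := by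
  have hfin : {P : HeightOneSpectrum c.A | ¬ RootClosed p (c.A ⧸ P.asIdeal)}.Finite := by
    by_contra hinf
    exact c.infinite_setOf_not_isNDivisible hC hp.ne_zero hinf h
  rcases _root_.isNClosed_or_quadraticallyClosedOverI (k := k) c.not_isField hp hpk hfin with
    hcl | ⟨rfl, hq⟩
  · exact .inl hcl
  · by_cases hi : IsSquare (-1 : k)
    · exact .inl (hq.isNClosed (by exact_mod_cast hpk) hi)
    · exact .inr ⟨rfl, hq, hi⟩

theorem isNDivisible_of_isNClosed {p : ℕ} (hp : p.Prime) (hpk : (p : k) ≠ 0)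
    (h : IsNClosed p k) (v : (PFField.functionField k C f hC).FinitePlace) :
    IsNDivisible p ((PFField.functionField k C f hC).LocalRing (.inl v))ˣ := by
  have := hC.isIntegral
  obtain ⟨c, P, hcP⟩ := exists_curveChart_isNDivisible_iff hC v hpk
  let := Ideal.Quotient.field P.asIdeal
  exact hcP.2 (h.rootClosed hp)

/-- A real closure of a formally real residue field would be a real closure of `k` carrying a point
of `C`. So no residue field is formally real, and all are closed under square roots. -/
theorem isNDivisible_two_of_hereditarilyEuclidean (h : HereditarilyEuclidean k)
    (hR : ∀ (R : Type u) [Field R] [Algebra k R], IsRealClosureOf k R → IsEmpty (PointsOver f R))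
    (v : (PFField.functionField k C f hC).FinitePlace) :
    IsNDivisible 2 ((PFField.functionField k C f hC).LocalRing (.inl v))ˣ := by
  have := hC.isIntegral
  have := h.isSemireal
  have h2 : ((2 : ℕ) : k) ≠ 0 := Nat.cast_ne_zero.2 two_ne_zero
  obtain ⟨c, P, hcP⟩ := exists_curveChart_isNDivisible_iff hC v h2
  let := Ideal.Quotient.field P.asIdeal
  refine hcP.2 (h.rootClosed fun hreal => ?_)
  have := hreal.isSemireal
  obtain ⟨R, _, _, hPR⟩ := exists_isRealClosureOf (c.A ⧸ P.asIdeal)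
  let : Algebra k R :=
    ((algebraMap (c.A ⧸ P.asIdeal) R).comp (algebraMap k (c.A ⧸ P.asIdeal))).toAlgebra
  have : IsScalarTower k (c.A ⧸ P.asIdeal) R := .of_algebraMap_eq fun _ => rfl
  have := hPR.isAlgebraic
  obtain ⟨p⟩ := c.nonempty_pointsOver
    ((IsScalarTower.toAlgHom k (c.A ⧸ P.asIdeal) R).comp (Ideal.Quotient.mkₐ k P.asIdeal))
  exact (hR R ⟨hPR.isRealClosed, Algebra.IsAlgebraic.trans k (c.A ⧸ P.asIdeal) R⟩).false p

/-- A point over `R` is supported at a closed point whose residue field embeds in `R`; divisibility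
there would put `√-1` in `R`. -/
theorem isEmpty_pointsOver_of_isNDivisible_two
    (h : ∀ v : (PFField.functionField k C f hC).FinitePlace,
      IsNDivisible 2 ((PFField.functionField k C f hC).LocalRing (.inl v))ˣ)
    (R : Type u) [Field R] [Algebra k R] (hR : IsRealClosureOf k R) :
    IsEmpty (PointsOver f R) := by
  have := hC.isIntegral
  refine ⟨fun p => ?_⟩
  obtain ⟨c, ⟨g⟩⟩ := hC.exists_algHom_of_pointsOver p
  have := hR.isAlgebraic
  have := hR.isRealClosed
  obtain ⟨P, hP⟩ := exists_heightOneSpectrum_of_algHom c.not_isField g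
  have hroot := c.rootClosed_of_isNDivisible hC two_ne_zero (h (c.place hC P))
  obtain ⟨b, hb⟩ := hroot (-1)
  let ψ : c.A ⧸ P.asIdeal →+* R := Ideal.Quotient.lift P.asIdeal g.toRingHom fun a ha => by
    rw [hP] at ha
    exact ha
  refine IsSemireal.not_isSquare_neg_one R ⟨ψ b, ?_⟩
  rw [← map_mul, ← sq, hb, map_neg, map_one]

theorem prime_mem_rho_functionField_iff [IsIntegral C] {p : ℕ} (hp : p.Prime) :
    p ∈ (PFField.functionField k C f hC).rho ↔
      (p ≠ ringChar k ∧ IsNClosed p k) ∨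
      (HereditarilyEuclidean k ∧ p = 2 ∧
        ∀ (R : Type u) [Field R] [Algebra k R], IsRealClosureOf k R →
          IsEmpty (PointsOver f R)) := by
  obtain ⟨c, -⟩ := hC.exists_curveChart (genericPoint C)
  rw [prime_mem_rho_iff hC hp]
  constructor
  · intro h
    have hempty : {v : (PFField.functionField k C f hC).Place |
        ¬ IsNDivisible p ((PFField.functionField k C f hC).LocalRing v)ˣ} = ∅ :=
      Set.eq_empty_of_forall_notMem fun v hv => hv (((prime_mem_rho_iff hC hp).2 h).2 v)
    have hpk : p ≠ ringChar k := fun hpk =>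
      (c.infinite_setOf_not_isNDivisible_of_eq_ringChar hC hp hpk).nonempty.ne_empty hempty
    have hpk0 := (natCast_ne_zero_iff_ne_ringChar hp).2 hpk
    rcases c.isNClosed_or_quadraticallyClosedOverI hC hp hpk0 (hempty ▸ Set.finite_empty) with
      hcl | ⟨rfl, hq, hi⟩
    · exact .inl ⟨hpk, hcl⟩
    · exact .inr ⟨hq.hereditarilyEuclidean (by exact_mod_cast hpk0) hi, rfl,
        fun R _ _ hR => isEmpty_pointsOver_of_isNDivisible_two hC h R hR⟩
  · rintro (⟨hpk, h⟩ | ⟨h, rfl, hR⟩)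
    · exact isNDivisible_of_isNClosed hC hp ((natCast_ne_zero_iff_ne_ringChar hp).2 hpk) h
    · exact isNDivisible_two_of_hereditarilyEuclidean hC h hR

/-- With finitely many bad places, only `p = 2` and `√-1 ∉ k` survives. The residue field at a bad
place then lacks `√-1`, since finite extensions containing it are closed under square roots. The
parity argument yields infinitely many such points, all of them bad because `-1` is not a square
there. -/
theorem infinite_setOf_not_isNDivisible_of_prime [IsIntegral C] {p : ℕ} (hp : p.Prime)
    (h : p ∉ (PFField.functionField k C f hC).rho) :
    {v : (PFField.functionField k C f hC).Place |
      ¬ IsNDivisible p ((PFField.functionField k C f hC).LocalRing v)ˣ}.Infinite := by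
  obtain ⟨c₀, -⟩ := hC.exists_curveChart (genericPoint C)
  by_cases hpk : p = ringChar k
  · exact c₀.infinite_setOf_not_isNDivisible_of_eq_ringChar hC hp hpk
  have hpk0 := (natCast_ne_zero_iff_ne_ringChar hp).2 hpk
  intro hfin
  rcases c₀.isNClosed_or_quadraticallyClosedOverI hC hp hpk0 hfin with hcl | ⟨rfl, hq, hi⟩
  · exact h ((prime_mem_rho_functionField_iff hC hp).2 (.inl ⟨hpk, hcl⟩))
  rw [prime_mem_rho_iff hC hp, not_forall] at h
  obtain ⟨v, hv⟩ := h
  have h2 : (2 : k) ≠ 0 := by exact_mod_cast hpk0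
  have := hq.isSemireal h2 hi
  obtain ⟨c, P, hcP⟩ := exists_curveChart_isNDivisible_iff hC v hpk0
  let := Ideal.Quotient.field P.asIdeal
  have hP : ¬ IsSquare (-1 : c.A ⧸ P.asIdeal) := fun hsq => hv (hcP.2 (hq _ hsq))
  refine c.infinite_setOf_not_isNDivisible hC two_ne_zero
    ((hq.infinite_setOf_not_isSquare_neg_one c.not_isField h2 hi hP).mono fun Q hQ hroot => ?_) hfin
  obtain ⟨b, hb⟩ := hroot (-1)
  exact hQ ⟨b, by rw [← hb, sq]⟩

theorem infinite_setOf_not_isNDivisible_functionField [IsIntegral C] {n : ℕ} (hn : 0 < n)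
    (h : n ∉ (PFField.functionField k C f hC).rho) :
    {v : (PFField.functionField k C f hC).Place |
      ¬ IsNDivisible n ((PFField.functionField k C f hC).LocalRing v)ˣ}.Infinite := by
  obtain ⟨p, hp, ⟨m, rfl⟩, hpr⟩ : ∃ p : ℕ, p.Prime ∧ p ∣ n ∧
      p ∉ (PFField.functionField k C f hC).rho := by
    by_contra! hall
    exact h ⟨hn, fun v => isNDivisible_of_forall_prime_dvd hn.ne' fun p hp hdvd =>
      (hall p hp hdvd).2 v⟩
  refine (infinite_setOf_not_isNDivisible_of_prime hC hp hpr).mono fun v hv hdiv => ?_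
  rw [mul_comm] at hdiv
  exact hv hdiv.of_mul_left

end FunctionField

end

theorem mainTheorem10 :
    (∀ (K : Type u) [Field K] [NumberField K], (PFField.numberField K).rho = {1}) ∧
    (∀ (k : Type u) [Field k] (C : Scheme.{u}) (f : C ⟶ Spec (.of k))
        (hC : IsRegularProjectiveCurve f) (p : ℕ), p.Prime →
      (p ∈ (PFField.functionField k C f hC).rho ↔
        (p ≠ ringChar k ∧ IsNClosed p k) ∨
        (HereditarilyEuclidean k ∧ p = 2 ∧
          ∀ (R : Type u) [Field R] [Algebra k R], IsRealClosureOf k R →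
            IsEmpty (PointsOver f R)))) ∧
    (∀ (F : PFField.{u}) (n : ℕ), 0 < n → n ∉ F.rho →
      {v : F.Place | ¬ IsNDivisible n (F.LocalRing v)ˣ}.Infinite) := by
  refine ⟨fun K _ _ => rho_numberField K, fun k _ C f hC p hp => ?_, fun F n hn h => ?_⟩
  · have := hC.isIntegral
    exact prime_mem_rho_functionField_iff hC hp
  · cases F with
    | numberField K =>
      refine infinite_setOf_not_isNDivisible_numberField K fun hn1 => h ?_
      rw [rho_numberField, hn1]
      rfl
    | functionField k C f hC =>
      have := hC.isIntegral
      exact infinite_setOf_not_isNDivisible_functionField hC hn h
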